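/- Let $\mathbb X\subset\mathbb R^d$ be a Borel set (state space) and $\mathbb U\subset\mathbb R^m$ a compact set (action space). Let $c:\mathbb X\times\mathbb U\to\mathbb R$ be a bounded Borel measurable cost such that $u\mapsto c(x,u)$ is continuous for every $x$. For a stochastic kernel $\mathcal T(dy|x,u)$ from $\mathbb X\times\mathbb U$ to $\mathbb X$, an initial state $x_0$ and an admissible policy $\gamma=(\gamma_t)_{t\ge0}$ (that is, $U_t=\gamma_t(X_0,\dots,X_t,U_0,\dots,U_{t-1})$ with $\gamma_t$ measurable), put $$J_\infty(\mathcal T,\gamma)=\limsup_{N\to\infty}\frac1N\,E^{\mathcal T,\gamma}_{x_0}\Big[\sum_{t=0}^{N-1}c(X_t,U_t)\Big],\qquad J^*_\infty(\mathcal T)=\inf_{\gamma\text{ admissible}}J_\infty(\mathcal T,\gamma).$$ A stationary policy is a measurable map $\gamma:\mathbb X\to\mathbb U$, used as $U_t=\gamma(X_t)$. Write $\Gamma_s$ for the set of stationary policies and $\mathcal T^t(\cdot|x,\gamma)$ for the $t$-step kernel of the chain with one-step kernel $\mathcal T(\cdot|x,\gamma(x))$. Let $\|\mu-\nu\|_{TV}=\sup\{|\int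 f\,d\mu-\int f\,d\nu|: f \text{ measurable},\ |f|\le1\}$. Let $\mathcal T$ and $\mathcal T_n$ ($n\in\mathbb N$) be stochastic kernels from $\mathbb X\times\mathbb U$ to $\mathbb X$ such that: 1. **(Uniform ergodicity)** At least one of the following holds for all kernels $\mathcal S\in\{\mathcal T,\mathcal T_1,\mathcal T_2,\dots\}$, with the numbers $t,\beta,\delta,\varepsilon,M,C$ and the rate in (i) the same for all these kernels, while $z,\mu,m,D,p_0$ may depend on $\mathcal S$ (but not on $x$ or $\gamma$), and $p,\mu_\gamma,\pi_\gamma$ may depend on $\mathcal S$ and $\gamma$. All inequalities are for all $x,x'\in\mathbb X$ and $\gamma\in\Gamma_s$. - (a) $\mathcal S(\{z\}|x,\gamma)\ge\beta$ for some state $z$, where $\beta>0$. - (b) $\mathcal S^t(\cdot|x,\gamma)\ge\mu$ for a measure $\mu$ with $\mu(\mathbb X)\ge\delta>0$, where $t\ge1$. - (c) $\mathcal S(\cdot|x,\gamma)$ has a density $p(\cdot|x,\gamma)$ with respect to a $\sigma$-finite measure $m$, with $p(y|x,\gamma)\ge\varepsilon>0$ for $y$ in a Borel set $D$ with $m(D)\ge\delta>0$.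 - (d) $\mathcal S(\cdot|x,\gamma)$ has a density $p(\cdot|x,\gamma)$ with respect to a $\sigma$-finite measure $m$, with $p(\cdot|x,\gamma)\ge p_0$ for a measurable $p_0\ge0$ with $\int p_0\,dm\ge\delta>0$. - (e) $\mathcal S^t(\cdot|x,\gamma)\le\mu$ for a measure $\mu$ with $\mu(\mathbb X)\le M<2$, where $t\ge1$. - (f) $\|\mathcal S^t(\cdot|x,\gamma)-\mathcal S^t(\cdot|x',\gamma)\|_{TV}\le2\beta$, where $t\ge1$ and $0<\beta<1$. - (g) $\mathcal S^t(\cdot|x,\gamma)\ge\beta\mu_\gamma$ for a probability measure $\mu_\gamma$, where $t\ge1$ and $\beta>0$. - (h) $\|\mathcal S^t(\cdot|x,\gamma)-\pi_\gamma\|_{TV}\le C\beta^t$ for all $t\ge1$ and a probability measure $\pi_\gamma$, where $C>0$ and $0<\beta<1$. - (i) $\|\mathcal S^t(\cdot|x,\gamma)-\pi_\gamma\|_{TV}\to0$ as $t\to\infty$ for probability measures $\pi_\gamma$, uniformly in $x$, $\gamma$ and $\mathcal S$. 2. **(Continuity in the action)** For every $x$ and every bounded measurable $f:\mathbb X\to\mathbb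 R$, the map $u\mapsto\int f(y)\,\mathcal T(dy|x,u)$ is continuous. 3. **(Convergence)** For every $x$ and all $u_n\to u$ in $\mathbb U$, $\|\mathcal T_n(\cdot|x,u_n)-\mathcal T(\cdot|x,u)\|_{TV}\to0$. Let $x_0\in\mathbb X$ and, for each $n$, let $\gamma_n^*$ be any stationary policy that is optimal for $\mathcal T_n$ and the initial state $x_0$, in the sense that $J_\infty(\mathcal T_n,\gamma_n^*)\le J_\infty(\mathcal T_n,\gamma)$ for all $\gamma\in\Gamma_s$ (it need not solve the average cost optimality equation). Then $$|J_\infty(\mathcal T,\gamma_n^*)-J^*_\infty(\mathcal T)|\to0\qquad(n\to\infty).$$ -/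

import Mathlib

open MeasureTheory ProbabilityTheory Filter Topology
open scoped ENNReal

noncomputable section

namespace AvgCost

/-! ### Total variation -/

/-- The total variation distance, normalised so that it is at most `2` between probability
measures: the supremum of `|∫ f dμ - ∫ f dν|` over measurable `f` with `|f| ≤ 1`. -/
def tvDist {X : Type*} [MeasurableSpace X] (μ ν : Measure X) : ℝ :=
  ⨆ f : {f : X → ℝ // Measurable f ∧ ∀ x, |f x| ≤ 1}, |∫ x, f.1 x ∂μ - ∫ x, f.1 x ∂ν|

/-! ### Policies -/

/-- A (deterministic) admissible policy: the action at time `t` is a measurable function of the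
past states and actions `(X_s, U_s)`, `s < t`, and of the current state `X_t`. -/
structure Policy (X U : Type*) [MeasurableSpace X] [MeasurableSpace U] where
  act : (t : ℕ) → (Fin t → X × U) → X → U
  measurable_act : ∀ t, Measurable fun p : (Fin t → X × U) × X => act t p.1 p.2

/-- A (deterministic) stationary policy: a measurable map from states to actions. -/
structure StationaryPolicy (X U : Type*) [MeasurableSpace X] [MeasurableSpace U] where
  act : X → U
  measurable_act : Measurable act

variable {X U : Type*} [MeasurableSpace X] [MeasurableSpace U]

/-- A stationary policy, regarded as an admissible policy. -/
def StationaryPolicy.toPolicy (γ : StationaryPolicy X U) : Policy X U where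
  act := fun _ _ x => γ.act x
  measurable_act := fun _ => γ.measurable_act.comp measurable_snd

/-! ### The controlled process and its average cost -/

/-- The state-action pairs at the times `0, …, t`, indexed by `Fin (t + 1)`. -/
def histFin (t : ℕ) (h : (_i : Finset.Iic t) → X × U) : Fin (t + 1) → X × U :=
  fun i => h ⟨i.1, Finset.mem_Iic.2 (Nat.lt_succ_iff.1 i.2)⟩

/-- The last state-action pair of a history up to time `t`. -/
def histLast (t : ℕ) (h : (_i : Finset.Iic t) → X × U) : X × U :=
  h ⟨t, Finset.mem_Iic.2 le_rfl⟩

lemma measurable_histFin (t : ℕ) :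
    Measurable (histFin t : ((_i : Finset.Iic t) → X × U) → _) :=
  measurable_pi_lambda _ fun _ => measurable_pi_apply _

lemma measurable_histLast (t : ℕ) :
    Measurable (histLast t : ((_i : Finset.Iic t) → X × U) → _) :=
  measurable_pi_apply _

/-- The next state-action pair produced by a policy from the history `p.1` up to time `t` and the
new state `p.2`. -/
def nextPair (γ : Policy X U) (t : ℕ) (p : ((_i : Finset.Iic t) → X × U) × X) : X × U :=
  (p.2, γ.act (t + 1) (histFin t p.1) p.2)

lemma measurable_nextPair (γ : Policy X U) (t : ℕ) : Measurable (nextPair γ t) :=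
  measurable_snd.prodMk ((γ.measurable_act (t + 1)).comp
    (((measurable_histFin t).comp measurable_fst).prodMk measurable_snd))

/-- The conditional law of `(X_{t+1}, U_{t+1})` given the history up to time `t`: the state
`X_{t+1}` has law `T(· | X_t, U_t)`, and then `U_{t+1}` is chosen by the policy. -/
def stepKernel (T : Kernel (X × U) X) (γ : Policy X U) (t : ℕ) :
    Kernel ((_i : Finset.Iic t) → X × U) (X × U) :=
  (Kernel.id ×ₖ (T.comap (histLast t) (measurable_histLast t))).map (nextPair γ t)

instance (T : Kernel (X × U) X) [IsMarkovKernel T] (γ : Policy X U) (t : ℕ) :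
    IsMarkovKernel (stepKernel T γ t) :=
  Kernel.IsMarkovKernel.map _ (measurable_nextPair γ t)

/-- The law of the state-action process `(X_t, U_t)_{t ≥ 0}` started at `X_0 = x₀` under the
transition kernel `T` and the policy `γ`. -/
def processLaw (T : Kernel (X × U) X) [IsMarkovKernel T] (γ : Policy X U) (x₀ : X) :
    Measure (ℕ → X × U) :=
  Kernel.traj (X := fun _ => X × U) (stepKernel T γ) 0
    (fun _ => (x₀, γ.act 0 Fin.elim0 x₀))

/-- The infinite-horizon average expected cost
`limsup_N (1/N) E [∑_{t < N} c (X_t, U_t)]`. -/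
def avgCost (c : X × U → ℝ) (T : Kernel (X × U) X) [IsMarkovKernel T] (γ : Policy X U)
    (x₀ : X) : ℝ :=
  limsup (fun N : ℕ =>
    (1 / (N : ℝ)) * ∫ ω, (∑ t ∈ Finset.range N, c (ω t)) ∂(processLaw T γ x₀)) atTop

/-- The optimal average cost: the infimum over all admissible policies. -/
def optCost (c : X × U → ℝ) (T : Kernel (X × U) X) [IsMarkovKernel T] (x₀ : X) : ℝ :=
  ⨅ γ : Policy X U, avgCost c T γ x₀

/-- A stationary policy is optimal (for the initial state `x₀`) if no stationary policy has a
smaller average cost. In particular this holds if it attains the infimum over all admissible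
policies. -/
def IsOptimalStationary (c : X × U → ℝ) (T : Kernel (X × U) X) [IsMarkovKernel T] (x₀ : X)
    (γ : StationaryPolicy X U) : Prop :=
  ∀ γ' : StationaryPolicy X U, avgCost c T γ.toPolicy x₀ ≤ avgCost c T γ'.toPolicy x₀

/-! ### Uniform ergodicity conditions

The conditions are stated for a set `𝒮` of controlled transition kernels. In each of them the
numerical constants (times, rates, lower bounds for masses) serve all kernels of `𝒮` at once,
while points, sets, measures and densities may vary with the kernel. For a one-element set
`𝒮` this is the usual condition for a single controlled kernel. -/

/-- The one-step kernel `T(· | x, γ) = T(· | x, γ(x))`; its `t`-th power `closedLoop T γ ^ t` in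
the monoid of kernels (multiplication being composition) is the `t`-step kernel. -/
def closedLoop (T : Kernel (X × U) X) (γ : StationaryPolicy X U) : Kernel X X :=
  T.comap (fun x => (x, γ.act x)) (measurable_id.prodMk γ.measurable_act)

/-- (a) An atom that is reached in one step with probability bounded below. -/
def ErgAtom (𝒮 : Set (Kernel (X × U) X)) : Prop :=
  ∃ β : ℝ≥0∞, 0 < β ∧ ∀ T ∈ 𝒮, ∃ z : X, ∀ (x : X) (γ : StationaryPolicy X U),
    β ≤ closedLoop T γ x {z}

/-- (b) The `t`-step kernels dominate a common non-trivial measure. -/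
def ErgMinorant (𝒮 : Set (Kernel (X × U) X)) : Prop :=
  ∃ t : ℕ, 0 < t ∧ ∃ δ : ℝ≥0∞, 0 < δ ∧ ∀ T ∈ 𝒮, ∃ μ : Measure X, δ ≤ μ Set.univ ∧
    ∀ (x : X) (γ : StationaryPolicy X U), μ ≤ (closedLoop T γ ^ t) x

/-- (c) Densities bounded below by a constant on a set of positive measure. -/
def ErgDensityOn (𝒮 : Set (Kernel (X × U) X)) : Prop :=
  ∃ ε : ℝ≥0∞, 0 < ε ∧ ∃ δ : ℝ≥0∞, 0 < δ ∧ ∀ T ∈ 𝒮, ∃ m : Measure X, SigmaFinite m ∧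
    ∃ C : Set X, MeasurableSet C ∧ δ ≤ m C ∧ ∀ γ : StationaryPolicy X U, ∃ p : X → X → ℝ≥0∞,
      (∀ x, Measurable (p x) ∧ closedLoop T γ x = m.withDensity (p x)) ∧
      ∀ x, ∀ y ∈ C, ε ≤ p x y

/-- (d) Densities bounded below by a function of positive integral. -/
def ErgDensity (𝒮 : Set (Kernel (X × U) X)) : Prop :=
  ∃ δ : ℝ≥0∞, 0 < δ ∧ ∀ T ∈ 𝒮, ∃ m : Measure X, SigmaFinite m ∧
    ∃ p₀ : X → ℝ≥0∞, Measurable p₀ ∧ δ ≤ ∫⁻ y, p₀ y ∂m ∧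
    ∀ γ : StationaryPolicy X U, ∃ p : X → X → ℝ≥0∞,
      (∀ x, Measurable (p x) ∧ closedLoop T γ x = m.withDensity (p x)) ∧
      ∀ x y, p₀ y ≤ p x y

/-- (e) The `t`-step kernels are dominated by a common measure of mass less than `2`. -/
def ErgMajorant (𝒮 : Set (Kernel (X × U) X)) : Prop :=
  ∃ t : ℕ, 0 < t ∧ ∃ M : ℝ≥0∞, M < 2 ∧ ∀ T ∈ 𝒮, ∃ μ : Measure X, μ Set.univ ≤ M ∧
    ∀ (x : X) (γ : StationaryPolicy X U), (closedLoop T γ ^ t) x ≤ μ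

/-- (f) A `t`-step contraction in total variation. -/
def ErgContraction (𝒮 : Set (Kernel (X × U) X)) : Prop :=
  ∃ t : ℕ, 0 < t ∧ ∃ β : ℝ, 0 < β ∧ β < 1 ∧ ∀ T ∈ 𝒮,
    ∀ (x x' : X) (γ : StationaryPolicy X U),
      tvDist ((closedLoop T γ ^ t) x) ((closedLoop T γ ^ t) x') ≤ 2 * β

/-- (g) A `t`-step minorisation by policy-dependent probability measures. -/
def ErgDoeblin (𝒮 : Set (Kernel (X × U) X)) : Prop :=
  ∃ t : ℕ, 0 < t ∧ ∃ β : ℝ≥0∞, 0 < β ∧ ∀ T ∈ 𝒮, ∀ γ : StationaryPolicy X U,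
    ∃ μ : Measure X, IsProbabilityMeasure μ ∧ ∀ x : X, β • μ ≤ (closedLoop T γ ^ t) x

/-- (h) Uniform geometric ergodicity. -/
def ErgGeometric (𝒮 : Set (Kernel (X × U) X)) : Prop :=
  ∃ C β : ℝ, 0 < C ∧ 0 < β ∧ β < 1 ∧ ∀ T ∈ 𝒮, ∀ γ : StationaryPolicy X U,
    ∃ π : Measure X, IsProbabilityMeasure π ∧
      ∀ (x : X) (t : ℕ), 0 < t → tvDist ((closedLoop T γ ^ t) x) π ≤ C * β ^ t

/-- (i) Uniform ergodicity: convergence of the `t`-step kernels in total variation, uniformly in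
the initial state, the stationary policy and the kernel. -/
def ErgUniform (𝒮 : Set (Kernel (X × U) X)) : Prop :=
  ∃ π : Kernel (X × U) X → StationaryPolicy X U → Measure X,
    (∀ T ∈ 𝒮, ∀ γ, IsProbabilityMeasure (π T γ)) ∧
    ∀ ε : ℝ, 0 < ε → ∃ t₀ : ℕ, ∀ t ≥ t₀, ∀ T ∈ 𝒮, ∀ (γ : StationaryPolicy X U) (x : X),
      tvDist ((closedLoop T γ ^ t) x) (π T γ) ≤ ε

/-- At least one of the ergodicity conditions (a)-(i) holds uniformly over `𝒮`. -/
def UniformlyErgodic (𝒮 : Set (Kernel (X × U) X)) : Prop :=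
  ErgAtom 𝒮 ∨ ErgMinorant 𝒮 ∨ ErgDensityOn 𝒮 ∨ ErgDensity 𝒮 ∨ ErgMajorant 𝒮 ∨
    ErgContraction 𝒮 ∨ ErgDoeblin 𝒮 ∨ ErgGeometric 𝒮 ∨ ErgUniform 𝒮

/-- Setwise continuity of a controlled transition kernel in the action, for every state. -/
def SetwiseContinuousInAction [TopologicalSpace U] (T : Kernel (X × U) X) : Prop :=
  ∀ (x : X) (f : X → ℝ), Measurable f → (∃ M : ℝ, ∀ y, |f y| ≤ M) →
    Continuous fun u : U => ∫ y, f y ∂(T (x, u))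

end AvgCost

end

/-! The proof rests on one consequence of ergodicity, `UniformlyErgodic.oscContraction`: under each
of (a)-(i) there are `t` and `β < 1` such that `t` steps of any closed loop shrink the oscillation
of every bounded measurable function by the factor `β`, with the same `t` and `β` for all kernels
and all stationary policies. Minorants and majorants give this because the common part of two laws
cancels; the total variation conditions give it after an affine rescaling.

If `|c| ≤ M`, the expected cost at time `k` under a stationary policy is then within `2 M β ^ (k /
t)` of the average cost (`abs_integral_sub_avgCost_le`). This rate is uniform, so comparing average
costs under `Tn n` and `T` reduces to a fixed `k`. There, induction on `k`, compactness of `U` and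
dominated convergence suffice (`tendsto_integral_pow_sub`). Hence `J(Tn, γn) - J(T, γn) → 0` for
arbitrary stationary policies `γn` (`tendsto_avgCost_sub`).

Stationary policies also nearly attain the infimum over all admissible policies for `T`
(`exists_avgCost_le_optCost_add`). This is a vanishing discount argument: approximate solutions of
the discounted optimality equation have oscillation bounded independently of the discount factor
(`OscContraction.abs_sub_le_of_discounted`), so a factor close to 1 gives matching upper and lower
bounds for the average cost.

If `γ'` is nearly optimal for `T`, then up to vanishing errors `J(T, γn*) ≈ J(Tn, γn*) ≤ J(Tn, γ') ≈
J(T, γ')`, and the last is nearly `J*(T)`. The optimality of `γn*` enters only through the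
comparison with `γ'`. -/

namespace AvgCost

/-! ### Integrals of bounded functions -/

section Integrals

variable {X : Type*} [MeasurableSpace X]

lemma integrable_of_abs_le {μ : Measure X} [IsFiniteMeasure μ] {f : X → ℝ} (hf : Measurable f)
    {M : ℝ} (hM : ∀ x, |f x| ≤ M) : Integrable f μ :=
  Integrable.of_bound hf.aestronglyMeasurable M (ae_of_all _ fun x => by simpa using hM x)

lemma abs_integral_le_of_abs_le {μ : Measure X} [IsProbabilityMeasure μ] {f : X → ℝ} {M : ℝ}
    (hM : ∀ x, |f x| ≤ M) : |∫ x, f x ∂μ| ≤ M := by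
  simpa using norm_integral_le_of_norm_le_const (μ := μ) (f := f) (ae_of_all _ hM)

lemma integral_le_of_le {μ : Measure X} [IsProbabilityMeasure μ] {f : X → ℝ}
    (hf : Integrable f μ) {M : ℝ} (hM : ∀ x, f x ≤ M) : ∫ x, f x ∂μ ≤ M := by
  simpa using integral_mono hf (integrable_const M) hM

lemma le_integral_of_le {μ : Measure X} [IsProbabilityMeasure μ] {f : X → ℝ}
    (hf : Integrable f μ) {M : ℝ} (hM : ∀ x, M ≤ f x) : M ≤ ∫ x, f x ∂μ := by
  simpa using integral_mono (integrable_const M) hf hM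

lemma abs_le_of_osc_le {α : Type*} {f : α → ℝ} {R : ℝ} (hR : ∀ y y', |f y - f y'| ≤ R) (x y : α) :
    |f y| ≤ |f x| + R := by
  have := abs_sub_abs_le_abs_sub (f y) (f x)
  linarith [hR y x]

lemma integrable_of_osc_le {μ : Measure X} [IsFiniteMeasure μ] {f : X → ℝ} (hf : Measurable f)
    {R : ℝ} (hR : ∀ y y', |f y - f y'| ≤ R) : Integrable f μ := by
  rcases isEmpty_or_nonempty X with h | ⟨⟨x⟩⟩
  · rw [Subsingleton.elim μ 0]
    exact integrable_zero_measure
  · exact integrable_of_abs_le hf (abs_le_of_osc_le hR x)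

/-- The integrals of a function of oscillation `R` with respect to two finite measures of the same
mass `m` differ by at most `m * R`. -/
lemma abs_integral_sub_le_mul_osc {μ ν : Measure X} [IsFiniteMeasure μ] [IsFiniteMeasure ν]
    {f : X → ℝ} (hf : Measurable f) {R : ℝ} (hR : ∀ y y', |f y - f y'| ≤ R) {m : ℝ}
    (hμ : μ.real Set.univ = m) (hν : ν.real Set.univ = m) :
    |∫ x, f x ∂μ - ∫ x, f x ∂ν| ≤ m * R := by
  rcases isEmpty_or_nonempty X with h | h
  · rw [Subsingleton.elim μ 0] at *
    rw [Subsingleton.elim ν 0]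
    simp at hμ
    simp [← hμ]
  have hbb : BddBelow (Set.range f) := by
    obtain ⟨x⟩ := h
    refine ⟨f x - R, ?_⟩
    rintro _ ⟨y, rfl⟩
    linarith [(abs_le.1 (hR x y)).2]
  have hlo : ∀ y, (⨅ z, f z) ≤ f y := fun y => ciInf_le hbb y
  have hhi : ∀ y, f y ≤ (⨅ z, f z) + R := fun y => by
    have : f y - R ≤ ⨅ z, f z := le_ciInf fun z => by linarith [(abs_le.1 (hR y z)).2]
    linarith
  -- Since `a ≤ f ≤ a + R`, both integrals lie in the interval `[m * a, m * (a + R)]`.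
  set a := ⨅ z, f z
  have hfμ : Integrable f μ := integrable_of_osc_le hf hR
  have hfν : Integrable f ν := integrable_of_osc_le hf hR
  have h1 := integral_mono (integrable_const a) hfμ hlo
  have h2 := integral_mono (integrable_const a) hfν hlo
  have h3 := integral_mono hfμ (integrable_const (a + R)) hhi
  have h4 := integral_mono hfν (integrable_const (a + R)) hhi
  simp only [integral_const, smul_eq_mul, hμ, hν] at h1 h2 h3 h4
  rw [abs_le]
  constructor <;> nlinarith

/-- Two probability measures with a common minorant of mass `m`. -/
lemma abs_integral_sub_le_of_minorant {P Q μ : Measure X} [IsProbabilityMeasure P]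
    [IsProbabilityMeasure Q] (hP : μ ≤ P) (hQ : μ ≤ Q) {f : X → ℝ} (hf : Measurable f) {R : ℝ}
    (hR : ∀ y y', |f y - f y'| ≤ R) :
    |∫ x, f x ∂P - ∫ x, f x ∂Q| ≤ (1 - μ.real Set.univ) * R := by
  have : IsFiniteMeasure μ := isFiniteMeasure_of_le P hP
  have key : ∀ (P : Measure X) [IsProbabilityMeasure P], μ ≤ P →
      (∫ x, f x ∂P = ∫ x, f x ∂(P - μ) + ∫ x, f x ∂μ) ∧
        (P - μ).real Set.univ = 1 - μ.real Set.univ := by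
    intro P _ hP
    have h := Measure.sub_add_cancel_of_le hP
    constructor
    · rw [← integral_add_measure (integrable_of_osc_le hf hR) (integrable_of_osc_le hf hR), h]
    · have h2 : (P - μ + μ).real Set.univ = 1 := by rw [h]; simp
      rw [measureReal_add_apply] at h2
      linarith
  obtain ⟨h1, h2⟩ := key P hP
  obtain ⟨h3, h4⟩ := key Q hQ
  rw [h1, h3, add_sub_add_right_eq_sub]
  exact abs_integral_sub_le_mul_osc hf hR h2 h4

/-- Two probability measures with a common finite majorant of mass `m`. -/
lemma abs_integral_sub_le_of_majorant {P Q μ : Measure X} [IsProbabilityMeasure P]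
    [IsProbabilityMeasure Q] [IsFiniteMeasure μ] (hP : P ≤ μ) (hQ : Q ≤ μ) {f : X → ℝ}
    (hf : Measurable f) {R : ℝ} (hR : ∀ y y', |f y - f y'| ≤ R) :
    |∫ x, f x ∂P - ∫ x, f x ∂Q| ≤ (μ.real Set.univ - 1) * R := by
  have key : ∀ (P : Measure X) [IsProbabilityMeasure P], P ≤ μ →
      (∫ x, f x ∂μ = ∫ x, f x ∂(μ - P) + ∫ x, f x ∂P) ∧
        (μ - P).real Set.univ = μ.real Set.univ - 1 := by
    intro P _ hP
    have h := Measure.sub_add_cancel_of_le hP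
    constructor
    · rw [← integral_add_measure (integrable_of_osc_le hf hR) (integrable_of_osc_le hf hR), h]
    · have h2 : (μ - P + P).real Set.univ = μ.real Set.univ := by rw [h]
      rw [measureReal_add_apply, probReal_univ (μ := P)] at h2
      linarith
  obtain ⟨h1, h2⟩ := key P hP
  obtain ⟨h3, h4⟩ := key Q hQ
  have h5 := abs_integral_sub_le_mul_osc hf hR h2 h4
  -- The complements `μ - P` and `μ - Q` have equal mass, and passing to them only changes the sign
  -- of the difference.
  have h6 : ∫ x, f x ∂P - ∫ x, f x ∂Q = -(∫ x, f x ∂(μ - P) - ∫ x, f x ∂(μ - Q)) := by linarith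
  rwa [h6, abs_neg]

end Integrals

/-! ### Total variation between probability measures -/

section TotalVariation

variable {X : Type*} [MeasurableSpace X]

lemma abs_integral_sub_le_tvDist {μ ν : Measure X} [IsProbabilityMeasure μ]
    [IsProbabilityMeasure ν] {f : X → ℝ} (hf : Measurable f) (h : ∀ x, |f x| ≤ 1) :
    |∫ x, f x ∂μ - ∫ x, f x ∂ν| ≤ tvDist μ ν := by
  refine le_ciSup (f := fun f : {f : X → ℝ // Measurable f ∧ ∀ x, |f x| ≤ 1} =>
    |∫ x, f.1 x ∂μ - ∫ x, f.1 x ∂ν|) ⟨2, ?_⟩ ⟨f, hf, h⟩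
  rintro _ ⟨g, rfl⟩
  have h1 := abs_integral_le_of_abs_le (μ := μ) g.2.2
  have h2 := abs_integral_le_of_abs_le (μ := ν) g.2.2
  have h3 := abs_sub (∫ x, g.1 x ∂μ) (∫ x, g.1 x ∂ν)
  simp only
  linarith

lemma tvDist_le {μ ν : Measure X} {a : ℝ} (h : ∀ f : X → ℝ, Measurable f → (∀ x, |f x| ≤ 1) →
    |∫ x, f x ∂μ - ∫ x, f x ∂ν| ≤ a) : tvDist μ ν ≤ a := by
  have : Nonempty {f : X → ℝ // Measurable f ∧ ∀ x, |f x| ≤ 1} :=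
    ⟨⟨fun _ => 0, measurable_const, by simp⟩⟩
  exact ciSup_le fun f => h f.1 f.2.1 f.2.2

lemma tvDist_nonneg (μ ν : Measure X) : 0 ≤ tvDist μ ν :=
  Real.iSup_nonneg fun _ => abs_nonneg _

lemma tvDist_triangle (μ ν ρ : Measure X) [IsProbabilityMeasure μ] [IsProbabilityMeasure ν]
    [IsProbabilityMeasure ρ] : tvDist μ ρ ≤ tvDist μ ν + tvDist ν ρ :=
  tvDist_le fun f hf h => (abs_sub_le _ (∫ x, f x ∂ν) _).trans
    (add_le_add (abs_integral_sub_le_tvDist hf h) (abs_integral_sub_le_tvDist hf h))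

lemma tvDist_comm (μ ν : Measure X) : tvDist μ ν = tvDist ν μ := by
  simp only [tvDist, abs_sub_comm]

lemma abs_integral_sub_le_mul_tvDist {μ ν : Measure X} [IsProbabilityMeasure μ]
    [IsProbabilityMeasure ν] {f : X → ℝ} (hf : Measurable f) {M : ℝ} (hM : 0 < M)
    (h : ∀ x, |f x| ≤ M) : |∫ x, f x ∂μ - ∫ x, f x ∂ν| ≤ M * tvDist μ ν := by
  have h1 := abs_integral_sub_le_tvDist (μ := μ) (ν := ν) (f := fun x => M⁻¹ * f x)
    (hf.const_mul _) fun x => by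
      rw [abs_mul, abs_of_pos (inv_pos.2 hM), inv_mul_le_iff₀ hM, mul_one]
      exact h x
  rw [integral_const_mul, integral_const_mul, ← mul_sub, abs_mul, abs_of_pos (inv_pos.2 hM),
    inv_mul_le_iff₀ hM] at h1
  exact h1

end TotalVariation

/-! ### Powers of Markov kernels -/

section Powers

variable {X : Type*} [MeasurableSpace X]

instance isMarkovKernel_pow (P : Kernel X X) [IsMarkovKernel P] (k : ℕ) :
    IsMarkovKernel (P ^ k) := by
  induction k with
  | zero => rw [pow_zero]; exact inferInstanceAs (IsMarkovKernel (Kernel.id : Kernel X X))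
  | succ k ih => rw [pow_succ]; exact inferInstanceAs (IsMarkovKernel ((P ^ k) ∘ₖ P))

lemma measurable_integral_kernel {Y : Type*} [MeasurableSpace Y] (P : Kernel Y X)
    {f : X → ℝ} (hf : Measurable f) : Measurable fun x => ∫ y, f y ∂P x :=
  hf.stronglyMeasurable.integral_kernel.measurable

lemma integral_pow_zero (P : Kernel X X) {f : X → ℝ} (hf : Measurable f) (x : X) :
    ∫ y, f y ∂(P ^ 0) x = f x := by
  rw [pow_zero]
  change ∫ y, f y ∂((Kernel.id : Kernel X X) x) = f x
  rw [Kernel.id_apply, integral_dirac' _ _ hf.stronglyMeasurable]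

lemma integral_pow_add (P : Kernel X X) [IsMarkovKernel P] {f : X → ℝ} (hf : Measurable f)
    {M : ℝ} (hM : ∀ x, |f x| ≤ M) (j k : ℕ) (x : X) :
    ∫ y, f y ∂(P ^ (j + k)) x = ∫ z, ∫ y, f y ∂(P ^ j) z ∂(P ^ k) x := by
  have h : P ^ (j + k) = (P ^ j) ∘ₖ (P ^ k) := pow_add P j k
  have : IsMarkovKernel ((P ^ j) ∘ₖ (P ^ k)) := by rw [← h]; infer_instance
  rw [h, Kernel.integral_comp (integrable_of_abs_le hf hM)]

end Powers

/-! ### Contraction of oscillations -/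

section Contraction

variable {X U : Type*} [MeasurableSpace X] [MeasurableSpace U]

instance (T : Kernel (X × U) X) [IsMarkovKernel T] (γ : StationaryPolicy X U) :
    IsMarkovKernel (closedLoop T γ) := by
  unfold closedLoop; infer_instance

lemma closedLoop_apply (T : Kernel (X × U) X) (γ : StationaryPolicy X U) (x : X) :
    closedLoop T γ x = T (x, γ.act x) := rfl

/-- The `t`-th power of `P` contracts the oscillation of functions by the factor `β`. -/
def OscContraction (P : Kernel X X) (t : ℕ) (β : ℝ) : Prop :=
  ∀ f : X → ℝ, Measurable f → ∀ R : ℝ, (∀ y y', |f y - f y'| ≤ R) →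
    ∀ x x', |∫ y, f y ∂(P ^ t) x - ∫ y, f y ∂(P ^ t) x'| ≤ β * R

/-- An affine map carries a function of oscillation at most `R` into `[-1, 1]`; it scales
differences of integrals by `2 / R` and its constant part cancels. -/
lemma OscContraction.of_unit_ball {P : Kernel X X} [IsMarkovKernel P] {t : ℕ} {β : ℝ}
    (hβ : 0 ≤ β)
    (h : ∀ f : X → ℝ, Measurable f → (∀ y, |f y| ≤ 1) →
      ∀ x x', |∫ y, f y ∂(P ^ t) x - ∫ y, f y ∂(P ^ t) x'| ≤ 2 * β) :
    OscContraction P t β := by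
  intro f hf R hR x x'
  have hR0 : 0 ≤ R := (abs_nonneg _).trans (hR x x)
  -- `R` may be zero, so the rescaling divides by some `R' > 0` above it, which is sent to `R` at
  -- the end.
  have key : ∀ R', 0 < R' → R ≤ R' →
      |∫ y, f y ∂(P ^ t) x - ∫ y, f y ∂(P ^ t) x'| ≤ β * R' := by
    intro R' hR' hRR
    have hbb : BddBelow (Set.range f) := by
      refine ⟨f x - R, ?_⟩
      rintro _ ⟨y, rfl⟩
      linarith [(abs_le.1 (hR x y)).2]
    have hlo : ∀ y, (⨅ z, f z) ≤ f y := fun y => ciInf_le hbb y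
    have hhi : ∀ y, f y ≤ (⨅ z, f z) + R := fun y => by
      have : Nonempty X := ⟨x⟩
      have : f y - R ≤ ⨅ z, f z := le_ciInf fun z => by linarith [(abs_le.1 (hR y z)).2]
      linarith
    set a := ⨅ z, f z
    have hg := h (fun y => 2 / R' * (f y - a) - 1)
      (((hf.sub_const a).const_mul _).sub_const 1) (fun y => by
        rw [abs_le]
        constructor
        · have : 0 ≤ 2 / R' * (f y - a) := mul_nonneg (by positivity) (by linarith [hlo y])
          linarith
        · have : 2 / R' * (f y - a) ≤ 2 := by
            rw [div_mul_eq_mul_div, div_le_iff₀ hR']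
            linarith [hhi y]
          linarith) x x'
    have hint : ∀ z, ∫ y, (2 / R' * (f y - a) - 1) ∂(P ^ t) z
        = 2 / R' * (∫ y, f y ∂(P ^ t) z - a) - 1 := by
      intro z
      have hfi : Integrable f ((P ^ t) z) := integrable_of_osc_le hf hR
      have hfa : Integrable (fun y => f y - a) ((P ^ t) z) := hfi.sub (integrable_const a)
      rw [integral_sub (hfa.const_mul _) (integrable_const _), integral_const_mul,
        integral_sub hfi (integrable_const a)]
      simp
    rw [hint, hint, sub_sub_sub_cancel_right, ← mul_sub, sub_sub_sub_cancel_right, abs_mul,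
      abs_of_pos (by positivity), div_mul_eq_mul_div, div_le_iff₀ hR'] at hg
    linarith
  refine le_of_forall_pos_le_add fun ε hε => ?_
  have h1 := key (R + ε / (β + 1)) (by positivity) (le_add_of_nonneg_right (by positivity))
  have h2 : β * (ε / (β + 1)) ≤ ε := by
    rw [mul_div_assoc', div_le_iff₀ (by positivity)]
    nlinarith
  linarith

variable {𝒮 : Set (Kernel (X × U) X)}

/-- A minorisation of the `t`-step kernels by measures of mass at least `δ`, which may depend on the
kernel and on the policy, yields a uniform contraction of oscillations. -/
lemma oscContraction_of_minorant (hS : ∀ S ∈ 𝒮, IsMarkovKernel S) {t : ℕ} {δ : ℝ≥0∞} (hδ : 0 < δ)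
    (h : ∀ T ∈ 𝒮, ∀ γ : StationaryPolicy X U, ∃ μ : Measure X, δ ≤ μ Set.univ ∧
      ∀ x, μ ≤ (closedLoop T γ ^ t) x) :
    ∃ β : ℝ, 0 ≤ β ∧ β < 1 ∧
      ∀ S ∈ 𝒮, ∀ γ : StationaryPolicy X U, OscContraction (closedLoop S γ) t β := by
  -- Truncation at `1` guards against `δ = ∞`, whose `toReal` is `0`, and keeps the factor
  -- nonnegative.
  refine ⟨1 - (min δ 1).toReal, ?_, ?_, ?_⟩
  · have : (min δ 1).toReal ≤ (1 : ℝ≥0∞).toReal :=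
      ENNReal.toReal_mono ENNReal.one_ne_top (min_le_right _ _)
    simpa using this
  · have : 0 < (min δ 1).toReal := ENNReal.toReal_pos (by simp [hδ.ne'])
      (ne_top_of_le_ne_top ENNReal.one_ne_top (min_le_right _ _))
    linarith
  · intro S hSS γ f hf R hR x x'
    have := hS S hSS
    obtain ⟨μ, hμ, hle⟩ := h S hSS γ
    have : IsFiniteMeasure μ := isFiniteMeasure_of_le _ (hle x)
    refine (abs_integral_sub_le_of_minorant (hle x) (hle x') hf hR).trans ?_
    have hR0 : 0 ≤ R := (abs_nonneg _).trans (hR x x)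
    have h1 : (min δ 1).toReal ≤ μ.real Set.univ :=
      ENNReal.toReal_mono (measure_ne_top _ _) ((min_le_left _ _).trans hμ)
    gcongr

lemma ErgAtom.ergMinorant (h : ErgAtom 𝒮) : ErgMinorant 𝒮 := by
  obtain ⟨β, hβ, h⟩ := h
  refine ⟨1, one_pos, β, hβ, fun T hT => ?_⟩
  obtain ⟨z, hz⟩ := h T hT
  refine ⟨β • Measure.dirac z, by simp, fun x γ => ?_⟩
  rw [pow_one, Measure.le_iff]
  intro s hs
  rw [Measure.smul_apply, Measure.dirac_apply' _ hs, smul_eq_mul]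
  by_cases hzs : z ∈ s
  · rw [Set.indicator_of_mem hzs, Pi.one_apply, mul_one]
    exact (hz x γ).trans (measure_mono (Set.singleton_subset_iff.2 hzs))
  · simp [hzs]

lemma ErgDensity.ergMinorant (h : ErgDensity 𝒮) : ErgMinorant 𝒮 := by
  obtain ⟨δ, hδ, h⟩ := h
  refine ⟨1, one_pos, δ, hδ, fun T hT => ?_⟩
  obtain ⟨m, -, p₀, hp₀, hδp, hp⟩ := h T hT
  refine ⟨m.withDensity p₀, by simpa using hδp, fun x γ => ?_⟩
  obtain ⟨p, hpm, hle⟩ := hp γ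
  rw [pow_one, (hpm x).2]
  exact withDensity_mono (ae_of_all _ (hle x))

lemma ErgDensityOn.ergDensity (h : ErgDensityOn 𝒮) : ErgDensity 𝒮 := by
  obtain ⟨ε, hε, δ, hδ, h⟩ := h
  refine ⟨ε * δ, ENNReal.mul_pos hε.ne' hδ.ne', fun T hT => ?_⟩
  obtain ⟨m, hm, D, hD, hδD, hp⟩ := h T hT
  refine ⟨m, hm, D.indicator fun _ => ε, measurable_const.indicator hD, ?_, fun γ => ?_⟩
  · rw [lintegral_indicator hD, setLIntegral_const]
    gcongr
  · obtain ⟨p, hpm, hle⟩ := hp γ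
    refine ⟨p, hpm, fun x y => ?_⟩
    by_cases hy : y ∈ D
    · simpa [hy] using hle x y hy
    · simp [hy]

/-- What the majorant leaves over each law has mass at most `M - 1 < 1`, and this is the contraction
factor. The maximum with `1` keeps it nonnegative. -/
lemma ErgMajorant.oscContraction [Nonempty X] [Nonempty (StationaryPolicy X U)]
    (hS : ∀ S ∈ 𝒮, IsMarkovKernel S) (h : ErgMajorant 𝒮) :
    ∃ t : ℕ, 0 < t ∧ ∃ β : ℝ, 0 ≤ β ∧ β < 1 ∧
      ∀ S ∈ 𝒮, ∀ γ : StationaryPolicy X U, OscContraction (closedLoop S γ) t β := by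
  obtain ⟨t, ht, M, hM, h⟩ := h
  have hMt : max M 1 ≠ ∞ := by simp [(hM.trans ENNReal.ofNat_lt_top).ne]
  refine ⟨t, ht, (max M 1).toReal - 1, ?_, ?_, ?_⟩
  · have : (1 : ℝ≥0∞).toReal ≤ (max M 1).toReal := ENNReal.toReal_mono hMt (le_max_right _ _)
    simpa using this
  · have : (max M 1).toReal < (2 : ℝ≥0∞).toReal :=
      (ENNReal.toReal_lt_toReal hMt ENNReal.ofNat_ne_top).2 (max_lt hM ENNReal.one_lt_two)
    simp at this
    linarith
  · intro S hSS γ f hf R hR x x'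
    have := hS S hSS
    obtain ⟨μ, hμ, hle⟩ := h S hSS
    have : IsFiniteMeasure μ := ⟨hμ.trans_lt (hM.trans ENNReal.ofNat_lt_top)⟩
    refine (abs_integral_sub_le_of_majorant (hle x γ) (hle x' γ) hf hR).trans ?_
    have hR0 : 0 ≤ R := (abs_nonneg _).trans (hR x x)
    have h1 : μ.real Set.univ ≤ (max M 1).toReal :=
      ENNReal.toReal_mono hMt (hμ.trans (le_max_left _ _))
    gcongr

lemma OscContraction.of_tvDist_le {P : Kernel X X} [IsMarkovKernel P] {π : Measure X}
    [IsProbabilityMeasure π] {t : ℕ} (h : ∀ x, tvDist ((P ^ t) x) π ≤ 1 / 2) :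
    OscContraction P t (1 / 2) := by
  refine OscContraction.of_unit_ball (by norm_num) fun f hf hf1 x x' => ?_
  have h1 := abs_integral_sub_le_tvDist (μ := (P ^ t) x) (ν := π) hf hf1
  have h2 := abs_integral_sub_le_tvDist (μ := (P ^ t) x') (ν := π) hf hf1
  have h3 := abs_sub_le (∫ y, f y ∂(P ^ t) x) (∫ y, f y ∂π) (∫ y, f y ∂(P ^ t) x')
  rw [abs_sub_comm (∫ y, f y ∂π)] at h3
  linarith [h x, h x']

/-- Each of the ergodicity conditions yields a uniform contraction of oscillations. -/
lemma UniformlyErgodic.oscContraction [Nonempty X] [Nonempty (StationaryPolicy X U)]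
    (hS : ∀ S ∈ 𝒮, IsMarkovKernel S) (h : UniformlyErgodic 𝒮) :
    ∃ t : ℕ, 0 < t ∧ ∃ β : ℝ, 0 ≤ β ∧ β < 1 ∧
      ∀ S ∈ 𝒮, ∀ γ : StationaryPolicy X U, OscContraction (closedLoop S γ) t β := by
  have minor : ErgMinorant 𝒮 → ∃ t : ℕ, 0 < t ∧ ∃ β : ℝ, 0 ≤ β ∧ β < 1 ∧
      ∀ S ∈ 𝒮, ∀ γ : StationaryPolicy X U, OscContraction (closedLoop S γ) t β := by
    rintro ⟨t, ht, δ, hδ, h⟩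
    refine ⟨t, ht, oscContraction_of_minorant hS hδ fun T hT γ => ?_⟩
    obtain ⟨μ, hμ, hle⟩ := h T hT
    exact ⟨μ, hμ, fun x => hle x γ⟩
  rcases h with h | h | h | h | h | h | h | h | h
  · exact minor h.ergMinorant
  · exact minor h
  · exact minor h.ergDensity.ergMinorant
  · exact minor h.ergMinorant
  · exact h.oscContraction hS
  · obtain ⟨t, ht, β, hβ, hβ1, h⟩ := h
    refine ⟨t, ht, β, hβ.le, hβ1, fun S hSS γ => ?_⟩
    have := hS S hSS
    exact OscContraction.of_unit_ball hβ.le fun f hf hf1 x x' =>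
      (abs_integral_sub_le_tvDist hf hf1).trans (h S hSS x x' γ)
  · obtain ⟨t, ht, β, hβ, h⟩ := h
    refine ⟨t, ht, oscContraction_of_minorant hS hβ fun T hT γ => ?_⟩
    obtain ⟨μ, hμ, hle⟩ := h T hT γ
    exact ⟨β • μ, by simp, hle⟩
  · obtain ⟨C, β, hC, hβ, hβ1, h⟩ := h
    have hlim : Tendsto (fun t : ℕ => C * β ^ t) atTop (𝓝 0) := by
      simpa using (tendsto_pow_atTop_nhds_zero_of_lt_one hβ.le hβ1).const_mul C
    obtain ⟨t, ht, ht0⟩ := ((hlim.eventually (gt_mem_nhds (show (0 : ℝ) < 1 / 2 by norm_num))).and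
      (eventually_gt_atTop 0)).exists
    refine ⟨t, ht0, 1 / 2, by norm_num, by norm_num, fun S hSS γ => ?_⟩
    have := hS S hSS
    obtain ⟨π, hπ, hle⟩ := h S hSS γ
    exact OscContraction.of_tvDist_le fun x => (hle x t ht0).trans ht.le
  · obtain ⟨π, hπ, h⟩ := h
    obtain ⟨t₀, h⟩ := h (1 / 2) (by norm_num)
    refine ⟨t₀ + 1, t₀.succ_pos, 1 / 2, by norm_num, by norm_num, fun S hSS γ => ?_⟩
    have := hS S hSS
    have := hπ S hSS γ
    exact OscContraction.of_tvDist_le (h (t₀ + 1) t₀.le_succ S hSS γ)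

end Contraction

/-! ### Geometric convergence of the expected costs -/

section Decay

variable {X : Type*} [MeasurableSpace X] {P : Kernel X X} [IsMarkovKernel P]

/-- Each block of `t` steps contributes a factor `β`; the remaining `r` steps, averages over
probability measures, cannot increase the oscillation. -/
lemma OscContraction.abs_sub_le_pow_mul {t : ℕ} {β : ℝ} (h : OscContraction P t β) {f : X → ℝ}
    (hf : Measurable f) {M : ℝ} (hM : ∀ x, |f x| ≤ M) {R : ℝ} (hR : ∀ y y', |f y - f y'| ≤ R)
    (r j : ℕ) (x x' : X) :
    |∫ y, f y ∂(P ^ (t * j + r)) x - ∫ y, f y ∂(P ^ (t * j + r)) x'| ≤ β ^ j * R := by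
  induction j generalizing x x' with
  | zero =>
    simpa using abs_integral_sub_le_mul_osc (μ := (P ^ (t * 0 + r)) x)
      (ν := (P ^ (t * 0 + r)) x') hf hR (m := 1) (by simp) (by simp)
  | succ j ih =>
    rw [show t * (j + 1) + r = (t * j + r) + t by ring, integral_pow_add P hf hM,
      integral_pow_add P hf hM, pow_succ', mul_assoc]
    exact h _ (measurable_integral_kernel _ hf) _ ih x x'

lemma OscContraction.abs_sub_le {t : ℕ} {β : ℝ} (h : OscContraction P t β) {f : X → ℝ}
    (hf : Measurable f) {M : ℝ} (hM : ∀ x, |f x| ≤ M) (k : ℕ) (x x' : X) :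
    |∫ y, f y ∂(P ^ k) x - ∫ y, f y ∂(P ^ k) x'| ≤ β ^ (k / t) * (2 * M) := by
  have hR : ∀ y y', |f y - f y'| ≤ 2 * M := fun y y' => by
    linarith [abs_sub (f y) (f y'), hM y, hM y']
  have := h.abs_sub_le_pow_mul hf hM hR (k % t) (k / t) x x'
  rwa [Nat.div_add_mod] at this

lemma tendsto_pow_div_mul {t : ℕ} (ht : 0 < t) {β : ℝ} (hβ : 0 ≤ β) (hβ1 : β < 1) (R : ℝ) :
    Tendsto (fun k : ℕ => β ^ (k / t) * R) atTop (𝓝 0) := by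
  simpa using ((tendsto_pow_atTop_nhds_zero_of_lt_one hβ hβ1).comp
    (Nat.tendsto_div_const_atTop ht.ne')).mul_const R

/-- Under an oscillation contraction, the expectations `∫ f d(P^k)(x)` converge, at a rate which
depends only on the constants. -/
lemma OscContraction.exists_tendsto {t : ℕ} (ht : 0 < t) {β : ℝ} (hβ : 0 ≤ β) (hβ1 : β < 1)
    (h : OscContraction P t β) {f : X → ℝ} (hf : Measurable f) {M : ℝ} (hM : ∀ x, |f x| ≤ M)
    (x : X) : ∃ g, Tendsto (fun k => ∫ y, f y ∂(P ^ k) x) atTop (𝓝 g) ∧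
      ∀ k : ℕ, |∫ y, f y ∂(P ^ k) x - g| ≤ β ^ (k / t) * (2 * M) := by
  -- For `l = k + n`, the expectation after `l` steps is an average over `z` of the expectations
  -- after `k` steps from `z`, so the oscillation of the latter bounds the difference.
  have hstep : ∀ k l : ℕ, k ≤ l →
      dist (∫ y, f y ∂(P ^ k) x) (∫ y, f y ∂(P ^ l) x) ≤ β ^ (k / t) * (2 * M) := by
    intro k l hkl
    obtain ⟨n, rfl⟩ := Nat.exists_eq_add_of_le hkl
    rw [Real.dist_eq, integral_pow_add P hf hM]
    have hm := measurable_integral_kernel (P ^ k) hf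
    have hb : ∀ z, |∫ y, f y ∂(P ^ k) z| ≤ M := fun z => abs_integral_le_of_abs_le hM
    have hi := integrable_of_abs_le (μ := (P ^ n) x) hm hb
    have := abs_integral_le_of_abs_le (μ := (P ^ n) x)
      (f := fun z => ∫ y, f y ∂(P ^ k) x - ∫ y, f y ∂(P ^ k) z) (h.abs_sub_le hf hM k x)
    rw [integral_sub (integrable_const _) hi] at this
    simpa using this
  obtain ⟨g, hg⟩ := cauchySeq_tendsto_of_complete
    (cauchySeq_of_le_tendsto_0' _ hstep (tendsto_pow_div_mul ht hβ hβ1 (2 * M)))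
  refine ⟨g, hg, fun k => ?_⟩
  refine le_of_tendsto ((tendsto_const_nhds.sub hg).abs) ?_
  filter_upwards [eventually_ge_atTop k] with l hl
  exact hstep k l hl

end Decay

/-! ### Expectations under the law of the controlled process -/

section ControlledLaw

variable {X U : Type*} [MeasurableSpace X] [MeasurableSpace U]

instance (T : Kernel (X × U) X) [IsMarkovKernel T] (γ : Policy X U) (x₀ : X) :
    IsProbabilityMeasure (processLaw T γ x₀) := by
  unfold processLaw; infer_instance

lemma integral_processLaw_zero (T : Kernel (X × U) X) [IsMarkovKernel T] (γ : Policy X U) (x₀ : X)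
    {f : X × U → ℝ} (hf : Measurable f) :
    ∫ ω, f (ω 0) ∂(processLaw T γ x₀) = f (x₀, γ.act 0 Fin.elim0 x₀) := by
  let h₀ : (_i : Finset.Iic 0) → X × U := fun _ => (x₀, γ.act 0 Fin.elim0 x₀)
  have h : (processLaw T γ x₀).map (Preorder.frestrictLe (π := fun _ => X × U) 0)
      = Measure.dirac h₀ := by
    rw [processLaw, Kernel.traj_map_frestrictLe_apply, Kernel.partialTraj_self, Kernel.id_apply]
  have hm : Measurable fun q : (_i : Finset.Iic 0) → X × U => f (q ⟨0, by simp⟩) :=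
    hf.comp (measurable_pi_apply _)
  have h2 := integral_map (μ := processLaw T γ x₀)
    (Preorder.measurable_frestrictLe (X := fun _ => X × U) 0).aemeasurable
    hm.aestronglyMeasurable
  rw [h, integral_dirac' _ _ hm.stronglyMeasurable] at h2
  exact h2.symm

lemma stepKernel_apply (T : Kernel (X × U) X) [IsMarkovKernel T] (γ : Policy X U) (t : ℕ)
    (q : (_i : Finset.Iic t) → X × U) :
    stepKernel T γ t q = (T (histLast t q)).map fun y => nextPair γ t (q, y) := by
  rw [stepKernel, Kernel.map_apply _ (measurable_nextPair γ t), Kernel.prod_apply,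
    Kernel.id_apply, Kernel.comap_apply, Measure.dirac_prod,
    Measure.map_map (measurable_nextPair γ t) measurable_prodMk_left]
  rfl

/-- The tower property of the controlled process. -/
lemma integral_processLaw_succ (T : Kernel (X × U) X) [IsMarkovKernel T] (γ : Policy X U) (x₀ : X)
    {f : X × U → ℝ} (hf : Measurable f) {M : ℝ} (hM : ∀ p, |f p| ≤ M) (t : ℕ) :
    ∫ ω, f (ω (t + 1)) ∂(processLaw T γ x₀) =
      ∫ ω, ∫ y, f (nextPair γ t (Preorder.frestrictLe (π := fun _ => X × U) t ω, y)) ∂(T (ω t))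
        ∂(processLaw T γ x₀) := by
  have hfr := Preorder.measurable_frestrictLe (X := fun _ : ℕ => X × U) t
  let κ := Kernel.traj (X := fun _ => X × U) (stepKernel T γ) 0
  have hev : Measurable fun ω : ℕ → X × U => ω (t + 1) := measurable_pi_apply _
  -- The law of the pair at time `t + 1` is the step kernel integrated against the law of the
  -- history up to `t`.
  have hker : κ.map (fun ω => ω (t + 1)) =
      stepKernel T γ t ∘ₖ (κ.map (Preorder.frestrictLe (π := fun _ => X × U) t)) := by
    have h1 := Kernel.traj_comp_partialTraj (X := fun _ => X × U) (κ := stepKernel T γ)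
      (Nat.zero_le t)
    have h2 := Kernel.map_traj_succ_self (X := fun _ => X × U) (κ := stepKernel T γ) (a := t)
    rw [Kernel.traj_map_frestrictLe, ← h2, ← Kernel.map_comp, h1]
  have hlaw : processLaw T γ x₀ = κ (fun _ => (x₀, γ.act 0 Fin.elim0 x₀)) := rfl
  have hmeas : Measurable fun q : (_i : Finset.Iic t) → X × U => ∫ p, f p ∂(stepKernel T γ t q) :=
    measurable_integral_kernel _ hf
  calc ∫ ω, f (ω (t + 1)) ∂(processLaw T γ x₀)
      = ∫ p, f p ∂(κ.map (fun ω => ω (t + 1)) (fun _ => (x₀, γ.act 0 Fin.elim0 x₀))) := by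
        rw [Kernel.map_apply _ hev, integral_map hev.aemeasurable hf.aestronglyMeasurable, hlaw]
    _ = ∫ ω, ∫ p, f p ∂(stepKernel T γ t (Preorder.frestrictLe (π := fun _ => X × U) t ω))
          ∂(processLaw T γ x₀) := by
        have := Kernel.IsMarkovKernel.map κ hfr
        rw [hker, Kernel.integral_comp (integrable_of_abs_le hf hM), Kernel.map_apply _ hfr,
          integral_map hfr.aemeasurable hmeas.aestronglyMeasurable, hlaw]
    _ = _ := by
        refine integral_congr_ae (ae_of_all _ fun ω => ?_)
        have hn : Measurable fun y =>
            nextPair γ t (Preorder.frestrictLe (π := fun _ => X × U) t ω, y) :=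
          (measurable_nextPair γ t).comp measurable_prodMk_left
        simp only
        rw [stepKernel_apply, integral_map hn.aemeasurable hf.aestronglyMeasurable]
        rfl

lemma StationaryPolicy.measurable_comp_act (γ : StationaryPolicy X U) {f : X × U → ℝ}
    (hf : Measurable f) : Measurable fun x => f (x, γ.act x) :=
  hf.comp (measurable_id.prodMk γ.measurable_act)

/-- The tower property removes the last transition: the induction hypothesis is applied to `p ↦ ∫ f
(y, γ y) T(dy | p)`, which is why `f` is generalised. -/
lemma integral_processLaw_stationary (T : Kernel (X × U) X) [IsMarkovKernel T]
    (γ : StationaryPolicy X U) (x₀ : X) {f : X × U → ℝ} (hf : Measurable f) {M : ℝ}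
    (hM : ∀ p, |f p| ≤ M) (t : ℕ) :
    ∫ ω, f (ω t) ∂(processLaw T γ.toPolicy x₀) =
      ∫ x, f (x, γ.act x) ∂((closedLoop T γ ^ t) x₀) := by
  induction t generalizing f with
  | zero =>
    rw [integral_processLaw_zero _ _ _ hf, integral_pow_zero _ (γ.measurable_comp_act hf)]
    rfl
  | succ t ih =>
    rw [integral_processLaw_succ _ _ _ hf hM, add_comm t,
      integral_pow_add _ (γ.measurable_comp_act hf) (fun x => hM _)]
    refine (ih (f := fun p => ∫ y, f (y, γ.act y) ∂(T p))
      (measurable_integral_kernel T (γ.measurable_comp_act hf))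
      (fun p => abs_integral_le_of_abs_le fun y => hM _)).trans ?_
    simp only [pow_one, closedLoop_apply]

/-- The average cost as the upper limit of the averages of the expected costs. -/
lemma avgCost_eq {c : X × U → ℝ} (hc : Measurable c) {M : ℝ} (hM : ∀ p, |c p| ≤ M)
    (T : Kernel (X × U) X) [IsMarkovKernel T] (γ : Policy X U) (x₀ : X) :
    avgCost c T γ x₀ = limsup (fun N : ℕ =>
      (N : ℝ)⁻¹ * ∑ t ∈ Finset.range N, ∫ ω, c (ω t) ∂(processLaw T γ x₀)) atTop := by
  simp only [avgCost, one_div]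
  congr! with N
  exact integral_finsetSum _ fun t _ =>
    integrable_of_abs_le (hc.comp (measurable_pi_apply t)) fun _ => hM _

/-- The average cost of a stationary policy is approximated by the expected cost at a fixed time,
at a rate which depends only on the constants. -/
lemma abs_integral_sub_avgCost_le {c : X × U → ℝ} (hc : Measurable c) {M : ℝ}
    (hM : ∀ p, |c p| ≤ M) (T : Kernel (X × U) X) [IsMarkovKernel T] (γ : StationaryPolicy X U)
    {t : ℕ} (ht : 0 < t) {β : ℝ} (hβ : 0 ≤ β) (hβ1 : β < 1)
    (h : OscContraction (closedLoop T γ) t β) (x₀ : X) (k : ℕ) :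
    |∫ x, c (x, γ.act x) ∂((closedLoop T γ ^ k) x₀) - avgCost c T γ.toPolicy x₀|
      ≤ β ^ (k / t) * (2 * M) := by
  obtain ⟨g, hg, hk⟩ := h.exists_tendsto ht hβ hβ1 (γ.measurable_comp_act hc) (fun x => hM _) x₀
  rw [avgCost_eq hc hM]
  simp only [integral_processLaw_stationary T γ x₀ hc hM]
  -- Cesàro averages keep the limit `g`, so the average cost is `g` itself.
  rw [hg.cesaro.limsup_eq]
  exact hk k

end ControlledLaw

/-! ### Averages of sequences with a telescoping part -/

section Averages

lemma abs_average_le {a : ℕ → ℝ} {M : ℝ} (hM : ∀ t, |a t| ≤ M) (N : ℕ) :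
    |(N : ℝ)⁻¹ * ∑ t ∈ Finset.range N, a t| ≤ M := by
  have hM0 : 0 ≤ M := (abs_nonneg _).trans (hM 0)
  have h1 : |∑ t ∈ Finset.range N, a t| ≤ N * M := by
    refine (Finset.abs_sum_le_sum_abs _ _).trans ((Finset.sum_le_sum fun t _ => hM t).trans ?_)
    simp
  rw [abs_mul, abs_of_nonneg (by positivity : (0 : ℝ) ≤ (N : ℝ)⁻¹)]
  rcases Nat.eq_zero_or_pos N with rfl | hN
  · simpa using hM0
  · rw [inv_mul_le_iff₀ (by positivity)]
    exact h1

lemma isBoundedUnder_le_average {a : ℕ → ℝ} {M : ℝ} (hM : ∀ t, |a t| ≤ M) :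
    IsBoundedUnder (· ≤ ·) atTop fun N : ℕ => (N : ℝ)⁻¹ * ∑ t ∈ Finset.range N, a t :=
  isBoundedUnder_of ⟨M, fun N => (abs_le.1 (abs_average_le hM N)).2⟩

lemma isBoundedUnder_ge_average {a : ℕ → ℝ} {M : ℝ} (hM : ∀ t, |a t| ≤ M) :
    IsBoundedUnder (· ≥ ·) atTop fun N : ℕ => (N : ℝ)⁻¹ * ∑ t ∈ Finset.range N, a t :=
  isBoundedUnder_of ⟨-M, fun N => (abs_le.1 (abs_average_le hM N)).1⟩

/-- Serves for `v t = E[V(X_t)]`: the averaged sum telescopes to `(v 0 - v N) / N + L`, so a bounded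
`V` does not affect the long-run average. -/
lemma tendsto_telescoping_average {v : ℕ → ℝ} {B : ℝ} (hB : ∀ t, |v t| ≤ B) (L : ℝ) :
    Tendsto (fun N : ℕ => (N : ℝ)⁻¹ * ∑ t ∈ Finset.range N, (v t - v (t + 1) + L))
      atTop (𝓝 L) := by
  have h1 : Tendsto (fun N : ℕ => (N : ℝ)⁻¹ * (v 0 - v N)) atTop (𝓝 0) := by
    have h2 : Tendsto (fun N : ℕ => (N : ℝ)⁻¹ * (2 * B)) atTop (𝓝 0) := by
      simpa using tendsto_inv_atTop_nhds_zero_nat.mul_const (2 * B)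
    refine squeeze_zero_norm (fun N => ?_) h2
    rw [norm_mul, Real.norm_of_nonneg (by positivity : (0 : ℝ) ≤ (N : ℝ)⁻¹), Real.norm_eq_abs]
    gcongr
    linarith [abs_sub (v 0) (v N), hB 0, hB N]
  have h3 : Tendsto (fun N : ℕ => (N : ℝ)⁻¹ * (v 0 - v N) + L) atTop (𝓝 L) := by
    simpa using h1.add_const L
  refine h3.congr' ?_
  filter_upwards [eventually_gt_atTop 0] with N hN
  rw [Finset.sum_add_distrib, Finset.sum_range_sub', Finset.sum_const, Finset.card_range,
    nsmul_eq_mul]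
  field_simp

lemma le_limsup_average {a v : ℕ → ℝ} {M B L : ℝ} (hM : ∀ t, |a t| ≤ M) (hB : ∀ t, |v t| ≤ B)
    (h : ∀ t, v t - v (t + 1) + L ≤ a t) :
    L ≤ limsup (fun N : ℕ => (N : ℝ)⁻¹ * ∑ t ∈ Finset.range N, a t) atTop := by
  have hT := tendsto_telescoping_average hB L
  rw [← hT.limsup_eq]
  refine limsup_le_limsup (Eventually.of_forall fun N => ?_) hT.isBoundedUnder_ge.isCoboundedUnder_le
    (isBoundedUnder_le_average hM)
  simp only
  gcongr
  exact h _

lemma limsup_average_le {a v : ℕ → ℝ} {M B L : ℝ} (hM : ∀ t, |a t| ≤ M) (hB : ∀ t, |v t| ≤ B)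
    (h : ∀ t, a t ≤ v t - v (t + 1) + L) :
    limsup (fun N : ℕ => (N : ℝ)⁻¹ * ∑ t ∈ Finset.range N, a t) atTop ≤ L := by
  have hT := tendsto_telescoping_average hB L
  rw [← hT.limsup_eq]
  refine limsup_le_limsup (Eventually.of_forall fun N => ?_)
    (isBoundedUnder_ge_average hM).isCoboundedUnder_le hT.isBoundedUnder_le
  simp only
  gcongr
  exact h _

end Averages

/-! ### The discounted Bellman operator -/

section Discounted

variable {X U : Type*} [MeasurableSpace X] [MeasurableSpace U]

/-- The one-stage cost with terminal cost `α * V`. -/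
noncomputable def stageCost (c : X × U → ℝ) (T : Kernel (X × U) X) (α : ℝ) (V : X → ℝ)
    (p : X × U) : ℝ :=
  c p + α * ∫ y, V y ∂(T p)

lemma measurable_stageCost {c : X × U → ℝ} (hc : Measurable c) (T : Kernel (X × U) X) (α : ℝ)
    {V : X → ℝ} (hV : Measurable V) : Measurable (stageCost c T α V) :=
  hc.add ((measurable_integral_kernel T hV).const_mul α)

lemma abs_stageCost_le {c : X × U → ℝ} {M : ℝ} (hM : ∀ p, |c p| ≤ M) (T : Kernel (X × U) X)
    [IsMarkovKernel T] {α : ℝ} (hα : 0 ≤ α) {V : X → ℝ} {B : ℝ} (hB : ∀ x, |V x| ≤ B)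
    (p : X × U) : |stageCost c T α V p| ≤ M + α * B := by
  refine (abs_add_le _ _).trans (add_le_add (hM p) ?_)
  rw [abs_mul, abs_of_nonneg hα]
  exact mul_le_mul_of_nonneg_left (abs_integral_le_of_abs_le hB) hα

lemma abs_stageCost_sub_le (c : X × U → ℝ) (T : Kernel (X × U) X) [IsMarkovKernel T]
    {α : ℝ} (hα : 0 ≤ α) {V W : X → ℝ} (hV : Measurable V) (hW : Measurable W)
    {B B' : ℝ} (hB : ∀ x, |V x| ≤ B) (hB' : ∀ x, |W x| ≤ B') {D : ℝ} (hD : ∀ x, |V x - W x| ≤ D)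
    (p : X × U) : |stageCost c T α V p - stageCost c T α W p| ≤ α * D := by
  rw [stageCost, stageCost, add_sub_add_left_eq_sub, ← mul_sub, abs_mul, abs_of_nonneg hα,
    ← integral_sub (integrable_of_abs_le hV hB) (integrable_of_abs_le hW hB')]
  exact mul_le_mul_of_nonneg_left (abs_integral_le_of_abs_le hD) hα

variable [TopologicalSpace U] [TopologicalSpace.SeparableSpace U] [Nonempty U]

/-- The discounted Bellman operator; the infimum is taken over a countable dense set of actions. -/
noncomputable def bellman (c : X × U → ℝ) (T : Kernel (X × U) X) (α : ℝ) (V : X → ℝ) (x : X) : ℝ :=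
  ⨅ j : ℕ, stageCost c T α V (x, TopologicalSpace.denseSeq U j)

variable {c : X × U → ℝ} {M : ℝ} {T : Kernel (X × U) X} [IsMarkovKernel T] {α : ℝ}

lemma bddBelow_stageCost (hM : ∀ p, |c p| ≤ M) (hα : 0 ≤ α) {V : X → ℝ} {B : ℝ}
    (hB : ∀ x, |V x| ≤ B) (x : X) :
    BddBelow (Set.range fun j : ℕ => stageCost c T α V (x, TopologicalSpace.denseSeq U j)) := by
  refine ⟨-(M + α * B), ?_⟩
  rintro _ ⟨j, rfl⟩
  exact (abs_le.1 (abs_stageCost_le hM T hα hB _)).1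

omit [IsMarkovKernel T] in
lemma measurable_bellman (hc : Measurable c) {V : X → ℝ} (hV : Measurable V) :
    Measurable (bellman c T α V) :=
  Measurable.iInf fun _ => (measurable_stageCost hc T α hV).comp measurable_prodMk_right

lemma abs_bellman_le (hM : ∀ p, |c p| ≤ M) (hα : 0 ≤ α) {V : X → ℝ} {B : ℝ}
    (hB : ∀ x, |V x| ≤ B) (x : X) : |bellman c T α V x| ≤ M + α * B := by
  have h := fun j : ℕ => abs_le.1 (abs_stageCost_le hM T hα hB (x, TopologicalSpace.denseSeq U j))
  exact abs_le.2 ⟨le_ciInf fun j => (h j).1,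
    (ciInf_le (bddBelow_stageCost hM hα hB x) 0).trans (h 0).2⟩

lemma bellman_le_add (hM : ∀ p, |c p| ≤ M) (hα : 0 ≤ α) {V W : X → ℝ} (hV : Measurable V)
    (hW : Measurable W) {B B' : ℝ} (hB : ∀ x, |V x| ≤ B) (hB' : ∀ x, |W x| ≤ B') {D : ℝ}
    (hD : ∀ x, |V x - W x| ≤ D) (x : X) : bellman c T α V x ≤ bellman c T α W x + α * D := by
  rw [← sub_le_iff_le_add]
  refine le_ciInf fun j => ?_
  have h1 := ciInf_le (bddBelow_stageCost (T := T) hM hα hB x) j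
  have h2 := abs_le.1 (abs_stageCost_sub_le c T hα hV hW hB hB' hD (x, TopologicalSpace.denseSeq U j))
  unfold bellman
  linarith [h2.2]

lemma abs_bellman_sub_le (hM : ∀ p, |c p| ≤ M) (hα : 0 ≤ α) {V W : X → ℝ} (hV : Measurable V)
    (hW : Measurable W) {B B' : ℝ} (hB : ∀ x, |V x| ≤ B) (hB' : ∀ x, |W x| ≤ B') {D : ℝ}
    (hD : ∀ x, |V x - W x| ≤ D) (x : X) :
    |bellman c T α V x - bellman c T α W x| ≤ α * D := by
  have h1 := bellman_le_add (T := T) hM hα hV hW hB hB' hD x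
  have h2 := bellman_le_add (T := T) hM hα hW hV hB' hB (fun x => by
    rw [abs_sub_comm]; exact hD x) x
  exact abs_sub_le_iff.2 ⟨by linarith, by linarith⟩

/-- Value iteration: approximate solutions of the discounted optimality equation. -/
lemma exists_abs_bellman_sub_le (hc : Measurable c) (hM : ∀ p, |c p| ≤ M) (hα : 0 ≤ α)
    (hα1 : α < 1) {η : ℝ} (hη : 0 < η) : ∃ V : X → ℝ, Measurable V ∧ (∃ B, ∀ x, |V x| ≤ B) ∧
      ∀ x, |bellman c T α V x - V x| ≤ η := by
  -- The residual of the zero function is at most `M`, and each iteration multiplies the bound by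
  -- `α`.
  have hiter : ∀ k : ℕ, Measurable ((bellman c T α)^[k] 0) ∧
      (∃ B, ∀ x, |(bellman c T α)^[k] 0 x| ≤ B) ∧
      ∀ x, |bellman c T α ((bellman c T α)^[k] 0) x - (bellman c T α)^[k] 0 x| ≤ α ^ k * M := by
    intro k
    induction k with
    | zero =>
      refine ⟨measurable_const, ⟨0, by simp⟩, fun x => ?_⟩
      simpa using abs_bellman_le (T := T) hM hα (V := 0) (B := 0) (by simp) x
    | succ k ih =>
      obtain ⟨h1, ⟨B, hB⟩, h3⟩ := ih
      simp only [Function.iterate_succ_apply']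
      refine ⟨measurable_bellman hc h1, ⟨_, abs_bellman_le hM hα hB⟩, fun x => ?_⟩
      rw [pow_succ', mul_assoc]
      exact abs_bellman_sub_le hM hα (measurable_bellman hc h1) h1 (abs_bellman_le hM hα hB) hB h3 x
  have hlim : Tendsto (fun k : ℕ => α ^ k * M) atTop (𝓝 0) := by
    simpa using (tendsto_pow_atTop_nhds_zero_of_lt_one hα hα1).mul_const M
  obtain ⟨k, hk⟩ := (hlim.eventually (gt_mem_nhds hη)).exists
  obtain ⟨h1, h2, h3⟩ := hiter k
  exact ⟨_, h1, h2, fun x => (h3 x).trans hk.le⟩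

omit [IsMarkovKernel T] in
/-- A measurable selection of nearly minimising actions. -/
lemma exists_stageCost_le_bellman_add (hc : Measurable c) {V : X → ℝ} (hV : Measurable V)
    {η : ℝ} (hη : 0 < η) : ∃ γ : StationaryPolicy X U, ∀ x,
      stageCost c T α V (x, γ.act x) ≤ bellman c T α V x + η := by
  classical
  have hex : ∀ x : X, ∃ j : ℕ, stageCost c T α V (x, TopologicalSpace.denseSeq U j) < bellman c T α V x + η :=
    fun x => exists_lt_of_ciInf_lt (lt_add_of_pos_right _ hη)
  -- Choosing the least admissible index makes the selection measurable.
  refine ⟨⟨fun x => TopologicalSpace.denseSeq U (Nat.find (hex x)), ?_⟩, fun x => (Nat.find_spec (hex x)).le⟩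
  have hfind : Measurable fun x => Nat.find (hex x) := measurable_find hex fun j =>
    measurableSet_lt ((measurable_stageCost hc T α hV).comp measurable_prodMk_right)
      ((measurable_bellman hc hV).add_const η)
  exact (measurable_from_nat (f := TopologicalSpace.denseSeq U)).comp hfind

/-- Continuity of the cost and of the kernel in the action carries the bound from the dense sequence
to every action. -/
lemma bellman_le_stageCost (hM : ∀ p, |c p| ≤ M) (hc : ∀ x, Continuous fun u => c (x, u))
    (hT : SetwiseContinuousInAction T) (hα : 0 ≤ α) {V : X → ℝ} (hV : Measurable V) {B : ℝ}
    (hB : ∀ x, |V x| ≤ B) (x : X) (u : U) : bellman c T α V x ≤ stageCost c T α V (x, u) := by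
  have hcont : Continuous fun u => stageCost c T α V (x, u) :=
    (hc x).add ((hT x V hV ⟨B, hB⟩).const_mul α)
  refine (TopologicalSpace.denseRange_denseSeq U).induction_on (p := fun u => bellman c T α V x ≤
    stageCost c T α V (x, u)) u (isClosed_le continuous_const hcont) fun j => ?_
  exact ciInf_le (bddBelow_stageCost hM hα hB x) j

/-- The approximate discounted optimality equation, with a stationary policy which nearly attains
the minimum. -/
lemma exists_approx_optimality_equation (hc : Measurable c) (hM : ∀ p, |c p| ≤ M)
    (hcc : ∀ x, Continuous fun u => c (x, u)) (hT : SetwiseContinuousInAction T) (hα : 0 ≤ α)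
    (hα1 : α < 1) {η : ℝ} (hη : 0 < η) : ∃ V : X → ℝ, Measurable V ∧ (∃ B, ∀ x, |V x| ≤ B) ∧
      (∀ p : X × U, V p.1 ≤ stageCost c T α V p + η) ∧
      ∃ γ : StationaryPolicy X U, ∀ x, stageCost c T α V (x, γ.act x) ≤ V x + 2 * η := by
  obtain ⟨V, hV, ⟨B, hB⟩, hVη⟩ := exists_abs_bellman_sub_le (T := T) hc hM hα hα1 hη
  obtain ⟨γ, hγ⟩ := exists_stageCost_le_bellman_add (T := T) (α := α) hc hV hη
  refine ⟨V, hV, ⟨B, hB⟩, fun p => ?_, γ, fun x => ?_⟩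
  · have h1 := bellman_le_stageCost hM hcc hT hα hV hB p.1 p.2
    linarith [(abs_le.1 (hVη p.1)).1]
  · linarith [hγ x, (abs_le.1 (hVη x)).2]

end Discounted

/-! ### Oscillation of discounted value functions -/

section Oscillation

variable {X : Type*} [MeasurableSpace X] {P : Kernel X X} [IsMarkovKernel P]

lemma discounted_expansion {α : ℝ} {V r : X → ℝ} (hV : Measurable V) (hr : Measurable r) {B ρ : ℝ}
    (hB : ∀ x, |V x| ≤ B) (hρ : ∀ x, |r x| ≤ ρ) (h : ∀ x, V x = r x + α * ∫ y, V y ∂P x)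
    (n : ℕ) (x : X) : V x = ∑ k ∈ Finset.range n, α ^ k * ∫ y, r y ∂(P ^ k) x
      + α ^ n * ∫ y, V y ∂(P ^ n) x := by
  induction n with
  | zero => simpa using (integral_pow_zero P hV x).symm
  | succ n ih =>
    have h1 : ∫ y, V y ∂(P ^ n) x = ∫ y, r y ∂(P ^ n) x + α * ∫ y, V y ∂(P ^ (n + 1)) x := by
      rw [add_comm n, integral_pow_add P hV hB, pow_one, ← integral_const_mul, ← integral_add
        (integrable_of_abs_le hr hρ) ((integrable_of_abs_le (measurable_integral_kernel P hV)
          fun z => abs_integral_le_of_abs_le hB).const_mul α)]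
      exact integral_congr_ae (ae_of_all _ h)
    rw [Finset.sum_range_succ]
    nth_rewrite 1 [ih]
    rw [h1]
    ring

/-- Expanding `V` over `t` steps, each running term contributes at most `2 * ρ` and the remainder at
most `β * R`, where `R` is the oscillation of `V`. Hence `R ≤ 2 t ρ + β R`, and `R` is finite. The
resulting bound does not involve `α`, which permits `α → 1`. -/
lemma OscContraction.abs_sub_le_of_discounted {t : ℕ} {β : ℝ} (hβ1 : β < 1)
    (hP : OscContraction P t β) {α : ℝ} (hα : 0 ≤ α) (hα1 : α ≤ 1) {V r : X → ℝ}
    (hV : Measurable V) (hr : Measurable r) {B ρ : ℝ} (hB : ∀ x, |V x| ≤ B)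
    (hρ : ∀ x, |r x| ≤ ρ) (h : ∀ x, V x = r x + α * ∫ y, V y ∂P x) (x x' : X) :
    |V x - V x'| ≤ t * (2 * ρ) / (1 - β) := by
  have hbdd : BddAbove (Set.range fun p : X × X => |V p.1 - V p.2|) := by
    refine ⟨2 * B, ?_⟩
    rintro _ ⟨p, rfl⟩
    simp only
    linarith [abs_sub (V p.1) (V p.2), hB p.1, hB p.2]
  set R := ⨆ p : X × X, |V p.1 - V p.2| with hRdef
  have hR : ∀ y y', |V y - V y'| ≤ R := fun y y' => le_ciSup hbdd (y, y')
  have hstep : ∀ y y', |V y - V y'| ≤ t * (2 * ρ) + β * R := by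
    intro y y'
    have h1 : V y - V y' = ∑ k ∈ Finset.range t,
        α ^ k * (∫ z, r z ∂(P ^ k) y - ∫ z, r z ∂(P ^ k) y')
        + α ^ t * (∫ z, V z ∂(P ^ t) y - ∫ z, V z ∂(P ^ t) y') := by
      simp only [mul_sub, Finset.sum_sub_distrib]
      have e1 := discounted_expansion hV hr hB hρ h t y
      have e2 := discounted_expansion hV hr hB hρ h t y'
      linarith
    have h2 : ∀ a : ℝ, ∀ k : ℕ, |α ^ k * a| ≤ |a| := fun a k => by
      rw [abs_mul, abs_of_nonneg (pow_nonneg hα k)]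
      exact mul_le_of_le_one_left (abs_nonneg _) (pow_le_one₀ hα hα1)
    rw [h1]
    refine (abs_add_le _ _).trans (add_le_add ?_ ((h2 _ _).trans (hP V hV R hR y y')))
    refine (Finset.abs_sum_le_sum_abs _ _).trans ?_
    refine (Finset.sum_le_sum (g := fun _ => 2 * ρ) fun k _ => (h2 _ _).trans ?_).trans (by simp)
    have e1 := abs_integral_le_of_abs_le (μ := (P ^ k) y) hρ
    have e2 := abs_integral_le_of_abs_le (μ := (P ^ k) y') hρ
    linarith [abs_sub (∫ z, r z ∂(P ^ k) y) (∫ z, r z ∂(P ^ k) y')]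
  have : Nonempty (X × X) := ⟨(x, x')⟩
  have hRle : R ≤ t * (2 * ρ) + β * R := ciSup_le fun p => hstep p.1 p.2
  refine (hR x x').trans ?_
  rw [le_div_iff₀ (by linarith)]
  linarith

end Oscillation

/-! ### Nearly optimal stationary policies -/

section NearlyOptimal

variable {X U : Type*} [MeasurableSpace X] [MeasurableSpace U]
  {c : X × U → ℝ} {M : ℝ} {T : Kernel (X × U) X} [IsMarkovKernel T] {α : ℝ}

lemma abs_expectedCost_le (hM : ∀ p, |c p| ≤ M) (π : Policy X U) (x₀ : X) (t : ℕ) :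
    |∫ ω, c (ω t) ∂(processLaw T π x₀)| ≤ M :=
  abs_integral_le_of_abs_le fun _ => hM _

lemma abs_avgCost_le (hc : Measurable c) (hM : ∀ p, |c p| ≤ M) (π : Policy X U) (x₀ : X) :
    |avgCost c T π x₀| ≤ M := by
  have hM' := abs_expectedCost_le (T := T) hM π x₀
  rw [avgCost_eq hc hM, abs_le]
  exact ⟨le_limsup_average (v := 0) (B := 0) hM' (by simp) fun t => by
      simpa using (abs_le.1 (hM' t)).1,
    limsup_average_le (v := 0) (B := 0) hM' (by simp) fun t => by
      simpa using (abs_le.1 (hM' t)).2⟩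

lemma optCost_le (hc : Measurable c) (hM : ∀ p, |c p| ≤ M) (π : Policy X U) (x₀ : X) :
    optCost c T x₀ ≤ avgCost c T π x₀ := by
  refine ciInf_le ⟨-M, ?_⟩ π
  rintro _ ⟨π', rfl⟩
  exact (abs_le.1 (abs_avgCost_le hc hM π' x₀)).1

/-- An approximate subsolution of the discounted optimality equation bounds the average cost of all
admissible policies from below. -/
lemma le_avgCost_of_le_stageCost (hc : Measurable c) (hM : ∀ p, |c p| ≤ M) (hα1 : α ≤ 1)
    {V : X → ℝ} (hV : Measurable V) {B : ℝ} (hB : ∀ x, |V x| ≤ B) {K : ℝ} {x₀ : X}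
    (hK : ∀ x, |V x - V x₀| ≤ K) {η : ℝ} (h : ∀ p, V p.1 ≤ stageCost c T α V p + η)
    (π : Policy X U) : (1 - α) * (V x₀ - K) - η ≤ avgCost c T π x₀ := by
  rw [avgCost_eq hc hM]
  set μ := processLaw T π x₀
  have hmV : ∀ t : ℕ, Measurable fun ω : ℕ → X × U => V (ω t).1 := fun t =>
    hV.comp (measurable_fst.comp (measurable_pi_apply t))
  have hiV : ∀ t : ℕ, Integrable (fun ω : ℕ → X × U => V (ω t).1) μ := fun t =>
    integrable_of_abs_le (hmV t) fun _ => hB _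
  refine le_limsup_average (v := fun t => ∫ ω, V (ω t).1 ∂μ) (B := B)
    (abs_expectedCost_le hM π x₀) (fun t => abs_integral_le_of_abs_le fun _ => hB _) fun t => ?_
  have hsucc : ∫ ω, V (ω (t + 1)).1 ∂μ = ∫ ω, ∫ y, V y ∂(T (ω t)) ∂μ :=
    integral_processLaw_succ T π x₀ (hV.comp measurable_fst) (fun _ => hB _) t
  -- The subsolution inequality gives `E c ≥ E V(X_t) - E V(X_{t+1}) + (1 - α) E V(X_{t+1}) - η`;
  -- this bounds the term that does not telescope.
  have hge : V x₀ - K ≤ ∫ ω, V (ω (t + 1)).1 ∂μ :=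
    le_integral_of_le (hiV _) fun ω => by linarith [(abs_le.1 (hK (ω (t + 1)).1)).1]
  have hci : Integrable (fun ω : ℕ → X × U => c (ω t)) μ :=
    integrable_of_abs_le (hc.comp (measurable_pi_apply t)) fun _ => hM _
  have hTi : Integrable (fun ω : ℕ → X × U => ∫ y, V y ∂(T (ω t))) μ :=
    integrable_of_abs_le ((measurable_integral_kernel T hV).comp (measurable_pi_apply t))
      fun _ => abs_integral_le_of_abs_le hB
  have hle := integral_mono (hiV t) ((hci.add (hTi.const_mul α)).add (integrable_const η))
    fun ω => h (ω t)
  rw [integral_add' (hci.add (hTi.const_mul α)) (integrable_const η),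
    integral_add' hci (hTi.const_mul α), integral_const_mul, ← hsucc] at hle
  simp only [integral_const, probReal_univ, one_smul] at hle
  nlinarith

lemma avgCost_le_of_stageCost_le (hc : Measurable c) (hM : ∀ p, |c p| ≤ M) (hα1 : α ≤ 1)
    {V : X → ℝ} (hV : Measurable V) {B : ℝ} (hB : ∀ x, |V x| ≤ B) {K : ℝ} {x₀ : X}
    (hK : ∀ x, |V x - V x₀| ≤ K) {η : ℝ} {γ : StationaryPolicy X U}
    (h : ∀ x, stageCost c T α V (x, γ.act x) ≤ V x + η) :
    avgCost c T γ.toPolicy x₀ ≤ (1 - α) * (V x₀ + K) + η := by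
  rw [avgCost_eq hc hM]
  set P := closedLoop T γ with hP
  have hiV : ∀ t : ℕ, Integrable V ((P ^ t) x₀) := fun t => integrable_of_abs_le hV hB
  refine limsup_average_le (v := fun t => ∫ x, V x ∂((P ^ t) x₀)) (B := B)
    (abs_expectedCost_le hM _ x₀) (fun t => abs_integral_le_of_abs_le hB) fun t => ?_
  rw [integral_processLaw_stationary T γ x₀ hc hM]
  have hsucc : ∫ x, V x ∂((P ^ (t + 1)) x₀) = ∫ x, ∫ y, V y ∂(P x) ∂((P ^ t) x₀) := by
    rw [add_comm, integral_pow_add P hV hB, pow_one]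
  have hge : ∫ x, V x ∂((P ^ (t + 1)) x₀) ≤ V x₀ + K :=
    integral_le_of_le (hiV _) fun x => by linarith [(abs_le.1 (hK x)).2]
  have hci : Integrable (fun x => c (x, γ.act x)) ((P ^ t) x₀) :=
    integrable_of_abs_le (γ.measurable_comp_act hc) fun _ => hM _
  have hTi : Integrable (fun x => ∫ y, V y ∂(P x)) ((P ^ t) x₀) :=
    integrable_of_abs_le (measurable_integral_kernel P hV) fun _ => abs_integral_le_of_abs_le hB
  have hle := integral_mono (hci.add (hTi.const_mul α)) ((hiV t).add (integrable_const η)) h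
  rw [integral_add' hci (hTi.const_mul α), integral_add' (hiV t) (integrable_const η),
    integral_const_mul, ← hsucc] at hle
  simp only [integral_const, probReal_univ, one_smul] at hle
  nlinarith

variable [TopologicalSpace U] [TopologicalSpace.SeparableSpace U] [Nonempty U]

/-- Under a uniform contraction of oscillations there are nearly optimal stationary policies. -/
lemma exists_avgCost_le_optCost_add (hc : Measurable c) (hM : ∀ p, |c p| ≤ M)
    (hcc : ∀ x, Continuous fun u => c (x, u)) (hT : SetwiseContinuousInAction T)
    {t : ℕ} {β : ℝ} (hβ1 : β < 1)
    (hosc : ∀ γ : StationaryPolicy X U, OscContraction (closedLoop T γ) t β) (x₀ : X)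
    {ε : ℝ} (hε : 0 < ε) :
    ∃ γ : StationaryPolicy X U, avgCost c T γ.toPolicy x₀ ≤ optCost c T x₀ + ε := by
  have hM0 : 0 ≤ M := (abs_nonneg _).trans (hM (x₀, Classical.arbitrary U))
  -- `K` is the oscillation bound for `ρ = M + 2`, fixed before the discount factor `1 - s`. The
  -- upper and lower bounds below differ by `2 s K + 3 η ≤ 5 ε / 8`.
  set K : ℝ := t * (2 * (M + 2)) / (1 - β) with hK
  have hβ : 0 < 1 - β := by linarith
  have hK0 : 0 ≤ K := by positivity
  set s : ℝ := min 1 (ε / (8 * (K + 1))) with hs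
  have hs0 : 0 < s := lt_min one_pos (by positivity)
  have hs1 : s ≤ 1 := min_le_left _ _
  have hsK : s * K ≤ ε / 8 := by
    have : s * (8 * (K + 1)) ≤ ε := (le_div_iff₀ (by positivity)).1 (min_le_right _ _)
    nlinarith
  set η : ℝ := min 1 (ε / 8) with hη
  have hη0 : 0 < η := lt_min one_pos (by positivity)
  have hη1 : η ≤ 1 := min_le_left _ _
  have hηε : η ≤ ε / 8 := min_le_right _ _
  have hα : 0 ≤ 1 - s := by linarith
  obtain ⟨V, hV, ⟨B, hB⟩, hlow, γ, hγ⟩ := exists_approx_optimality_equation hc hM hcc hT hα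
    (by linarith) hη0
  have hVosc : ∀ x, |V x - V x₀| ≤ K := by
    intro x
    -- With this `r`, `V` solves the discounted equation of the chain exactly; near optimality and
    -- `η ≤ 1` place `r` within `2` of the true cost.
    refine (hosc γ).abs_sub_le_of_discounted hβ1 hα (by linarith)
      (r := fun x => V x - (1 - s) * ∫ y, V y ∂(closedLoop T γ x)) (ρ := M + 2) hV
      (hV.sub ((measurable_integral_kernel _ hV).const_mul _)) hB (fun y => ?_)
      (fun y => by ring) x x₀
    have h1 := hlow (y, γ.act y)
    have h2 := hγ y
    have h3 := abs_le.1 (hM (y, γ.act y))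
    simp only [stageCost] at h1 h2
    rw [closedLoop_apply, abs_le]
    constructor <;> linarith
  refine ⟨γ, ?_⟩
  have hup := avgCost_le_of_stageCost_le hc hM (by linarith) hV hB hVosc hγ
  have hinf : (1 - (1 - s)) * (V x₀ - K) - η ≤ optCost c T x₀ := by
    have : Nonempty (Policy X U) := ⟨γ.toPolicy⟩
    exact le_ciInf fun π => le_avgCost_of_le_stageCost hc hM (by linarith) hV hB hVosc hlow π
  nlinarith

end NearlyOptimal

/-! ### Continuous convergence in total variation -/

section Convergence

/-- Convergence along all sequences `un → u` amounts to convergence along `atTop ×ˢ 𝓝 u`. -/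
lemma tendsto_prod_of_forall_seq {U Y : Type*} [TopologicalSpace U] [FirstCountableTopology U]
    {l : Filter Y} {F : ℕ → U → Y} {u : U}
    (h : ∀ un : ℕ → U, Tendsto un atTop (𝓝 u) → Tendsto (fun n => F n (un n)) atTop l) :
    Tendsto (fun p : ℕ × U => F p.1 p.2) (atTop ×ˢ 𝓝 u) l := by
  refine tendsto_of_seq_tendsto fun z hz => tendsto_of_subseq_tendsto fun ns hns => ?_
  obtain ⟨hz1, hz2⟩ := tendsto_prod_iff'.1 (hz.comp hns)
  obtain ⟨φ, hφ, hzφ⟩ := strictMono_subseq_of_tendsto_atTop hz1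
  set m : ℕ → ℕ := (fun n => ((z ∘ ns) n).1) ∘ φ
  set v : ℕ → U := (fun n => ((z ∘ ns) n).2) ∘ φ
  have hv : Tendsto v atTop (𝓝 u) := hz2.comp hφ.tendsto_atTop
  -- The points `v k` are put at the strictly increasing indices `m k` and the gaps filled with `u`,
  -- giving a full sequence that converges to `u`.
  have hext : ∀ k, Function.extend m v (fun _ => u) (m k) = v k :=
    fun k => hzφ.injective.extend_apply _ _ _
  have hun : Tendsto (Function.extend m v fun _ => u) atTop (𝓝 u) := by
    intro W hW
    obtain ⟨K, hK⟩ := eventually_atTop.1 (hv.eventually_mem hW)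
    refine mem_map.2 (mem_atTop_sets.2 ⟨m K, fun n hn => ?_⟩)
    by_cases hex : ∃ k, m k = n
    · obtain ⟨k, rfl⟩ := hex
      rw [Set.mem_preimage, hext]
      exact hK k (hzφ.le_iff_le.1 hn)
    · rw [Set.mem_preimage, Function.extend_apply' _ _ _ hex]
      exact mem_of_mem_nhds hW
  refine ⟨φ, ((h _ hun).comp hzφ.tendsto_atTop).congr fun k => ?_⟩
  change F (m k) (Function.extend m v (fun _ => u) (m k)) = F (m k) (v k)
  rw [hext]

variable {X U : Type*} [MeasurableSpace X] [MeasurableSpace U] [TopologicalSpace U]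
  {T : Kernel (X × U) X} [IsMarkovKernel T] {Tn : ℕ → Kernel (X × U) X}
  [∀ n, IsMarkovKernel (Tn n)]

/-- The limit of a continuously convergent sequence of kernels is continuous in the action. -/
lemma tendsto_tvDist_of_tendsto_prod {x : X}
    (h : ∀ u, Tendsto (fun p : ℕ × U => tvDist (Tn p.1 (x, p.2)) (T (x, u)))
      (atTop ×ˢ 𝓝 u) (𝓝 0)) (u : U) :
    Tendsto (fun v => tvDist (T (x, v)) (T (x, u))) (𝓝 u) (𝓝 0) := by
  rw [Metric.tendsto_nhds]
  intro ε hε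
  have hlt : ∀ w, ∀ᶠ p : ℕ × U in atTop ×ˢ 𝓝 w,
      tvDist (Tn p.1 (x, p.2)) (T (x, w)) < ε / 2 :=
    fun w => (h w).eventually (gt_mem_nhds (by linarith))
  obtain ⟨pa, hpa, pb, hpb, hp⟩ := eventually_prod_iff.1 (hlt u)
  filter_upwards [hpb] with v hv
  obtain ⟨qa, hqa, qb, hqb, hq⟩ := eventually_prod_iff.1 (hlt v)
  -- One large `n`, allowed to depend on `v`, makes `Tn n (x, v)` close to both `T (x, u)` and `T
  -- (x, v)`.
  obtain ⟨n, hn1, hn2⟩ := (hpa.and hqa).exists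
  have h1 := hp hn1 hv
  have h2 := hq hn2 hqb.self_of_nhds
  have h3 := tvDist_triangle (T (x, v)) (Tn n (x, v)) (T (x, u))
  rw [tvDist_comm (T (x, v)) (Tn n (x, v))] at h3
  simp only at h1 h2
  rw [Real.dist_0_eq_abs, abs_of_nonneg (tvDist_nonneg _ _)]
  linarith

/-- The expectations after `k` steps under `Tn n` and under the limit `T`, with the same stationary
policies, become asymptotically equal, for arbitrary sequences of stationary policies. -/
lemma tendsto_integral_pow_sub [CompactSpace U]
    (h : ∀ x u, Tendsto (fun p : ℕ × U => tvDist (Tn p.1 (x, p.2)) (T (x, u)))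
      (atTop ×ˢ 𝓝 u) (𝓝 0)) (γ : ℕ → StationaryPolicy X U) {f : ℕ → X → ℝ}
    (hf : ∀ n, Measurable (f n)) {M : ℝ} (hM0 : 0 < M) (hM : ∀ n x, |f n x| ≤ M) (k : ℕ) (x : X) :
    Tendsto (fun n => ∫ y, f n y ∂((closedLoop (Tn n) (γ n) ^ k) x)
      - ∫ y, f n y ∂((closedLoop T (γ n) ^ k) x)) atTop (𝓝 0) := by
  induction k generalizing x with
  | zero =>
    refine tendsto_const_nhds.congr fun n => ?_
    rw [integral_pow_zero _ (hf n), integral_pow_zero _ (hf n), sub_self]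
  | succ k ih =>
    set p : ℕ → X → ℝ := fun n z => ∫ y, f n y ∂((closedLoop (Tn n) (γ n) ^ k) z)
    set q : ℕ → X → ℝ := fun n z => ∫ y, f n y ∂((closedLoop T (γ n) ^ k) z)
    have hpm : ∀ n, Measurable (p n) := fun n => measurable_integral_kernel _ (hf n)
    have hqm : ∀ n, Measurable (q n) := fun n => measurable_integral_kernel _ (hf n)
    have hpM : ∀ n z, |p n z| ≤ M := fun n z => abs_integral_le_of_abs_le (hM n)
    have hqM : ∀ n z, |q n z| ≤ M := fun n z => abs_integral_le_of_abs_le (hM n)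
    have hsucc : ∀ n, ∫ y, f n y ∂((closedLoop (Tn n) (γ n) ^ (k + 1)) x)
        - ∫ y, f n y ∂((closedLoop T (γ n) ^ (k + 1)) x)
        = ∫ z, p n z ∂(Tn n (x, (γ n).act x)) - ∫ z, q n z ∂(T (x, (γ n).act x)) := by
      intro n
      rw [integral_pow_add (closedLoop (Tn n) (γ n)) (hf n) (hM n) k 1 x,
        integral_pow_add (closedLoop T (γ n)) (hf n) (hM n) k 1 x, pow_one, pow_one,
        closedLoop_apply, closedLoop_apply]
    simp only [hsucc]
    -- The actions `γ n x` need not converge, but along any ultrafilter they do, since `U` is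
    -- compact.
    rw [tendsto_iff_ultrafilter]
    intro G hG
    obtain ⟨u, -, hu⟩ := isCompact_univ.ultrafilter_le_nhds (G.map fun n => (γ n).act x) (by simp)
    have hu' : Tendsto (fun n => (γ n).act x) G (𝓝 u) := hu
    have hid : Tendsto (fun n : ℕ => n) G atTop := hG
    have hpair : Tendsto (fun n => (n, (γ n).act x)) G (atTop ×ˢ 𝓝 u) := hid.prodMk hu'
    have hlim1 : Tendsto (fun n => tvDist (Tn n (x, (γ n).act x)) (T (x, u))) G (𝓝 0) := by
      simpa only [Function.comp_def] using Tendsto.comp (h x u) hpair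
    have hlim2 : Tendsto (fun n => tvDist (T (x, (γ n).act x)) (T (x, u))) G (𝓝 0) :=
      (tendsto_tvDist_of_tendsto_prod (h x) u).comp hu'
    -- Against the fixed law `T (x, u)`, the pointwise induction hypothesis and dominated
    -- convergence apply; the two other terms of `hbound` pay for replacing the moving laws by it.
    have hlim3 : Tendsto (fun n => ∫ z, (p n z - q n z) ∂(T (x, u))) G (𝓝 0) := by
      have := tendsto_integral_of_dominated_convergence (μ := T (x, u))
        (F := fun n z => p n z - q n z) (f := fun _ => 0) (fun _ => 2 * M)
        (fun n => ((hpm n).sub (hqm n)).aestronglyMeasurable) (integrable_const _)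
        (fun n => ae_of_all _ fun z => by
          rw [Real.norm_eq_abs]
          linarith [abs_sub (p n z) (q n z), hpM n z, hqM n z])
        (ae_of_all _ ih)
      rw [integral_zero] at this
      exact this.mono_left hG
    have hbound : Tendsto (fun n => M * tvDist (Tn n (x, (γ n).act x)) (T (x, u))
        + |∫ z, (p n z - q n z) ∂(T (x, u))|
        + M * tvDist (T (x, (γ n).act x)) (T (x, u))) G (𝓝 0) := by
      simpa using ((hlim1.const_mul M).add hlim3.abs).add (hlim2.const_mul M)
    refine squeeze_zero_norm (fun n => ?_) hbound
    have h1 := abs_integral_sub_le_mul_tvDist (μ := Tn n (x, (γ n).act x)) (ν := T (x, u))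
      (hpm n) hM0 (hpM n)
    have h2 := abs_integral_sub_le_mul_tvDist (μ := T (x, (γ n).act x)) (ν := T (x, u))
      (hqm n) hM0 (hqM n)
    rw [integral_sub (integrable_of_abs_le (hpm n) (hpM n))
      (integrable_of_abs_le (hqm n) (hqM n)), Real.norm_eq_abs]
    rw [abs_sub_comm] at h2
    refine le_trans ?_ (add_le_add (add_le_add_left h1 _) h2)
    refine le_trans (le_of_eq ?_) ((abs_add_le _ _).trans (add_le_add_left (abs_add_le _ _) _))
    ring_nf

/-- For uniformly contracting kernels, the average costs of arbitrary sequences of stationary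
policies under `Tn n` and under the limit `T` become asymptotically equal. -/
lemma tendsto_avgCost_sub [CompactSpace U] {c : X × U → ℝ} (hc : Measurable c) {M : ℝ}
    (hM0 : 0 < M) (hM : ∀ p, |c p| ≤ M) {t : ℕ} (ht : 0 < t) {β : ℝ} (hβ : 0 ≤ β) (hβ1 : β < 1)
    (h : ∀ x u, Tendsto (fun p : ℕ × U => tvDist (Tn p.1 (x, p.2)) (T (x, u)))
      (atTop ×ˢ 𝓝 u) (𝓝 0))
    (hT : ∀ γ : StationaryPolicy X U, OscContraction (closedLoop T γ) t β)
    (hTn : ∀ n, ∀ γ : StationaryPolicy X U, OscContraction (closedLoop (Tn n) γ) t β)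
    (γ : ℕ → StationaryPolicy X U) (x₀ : X) :
    Tendsto (fun n => avgCost c (Tn n) (γ n).toPolicy x₀ - avgCost c T (γ n).toPolicy x₀)
      atTop (𝓝 0) := by
  rw [Metric.tendsto_nhds]
  intro ε hε
  -- The rate is uniform, so one `k` serves all `n` and all policies.
  obtain ⟨k, hk⟩ := ((tendsto_pow_div_mul ht hβ hβ1 (2 * M)).eventually
    (gt_mem_nhds (show 0 < ε / 3 by linarith))).exists
  have hlim := tendsto_integral_pow_sub h γ (f := fun n x => c (x, (γ n).act x))
    (fun n => (γ n).measurable_comp_act hc) hM0 (fun n x => hM _) k x₀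
  filter_upwards [(Metric.tendsto_nhds.1 hlim) (ε / 3) (by linarith)] with n hn
  rw [Real.dist_0_eq_abs] at hn ⊢
  have h1 := abs_le.1 (abs_integral_sub_avgCost_le hc hM (Tn n) (γ n) ht hβ hβ1 (hTn n _) x₀ k)
  have h2 := abs_le.1 (abs_integral_sub_avgCost_le hc hM T (γ n) ht hβ hβ1 (hT _) x₀ k)
  have h3 := abs_lt.1 hn
  rw [abs_lt]
  constructor <;> linarith [h1.1, h1.2, h2.1, h2.2, h3.1, h3.2]

end Convergence

end AvgCost

theorem mainTheorem4 {d m : ℕ}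
    (X : Set (EuclideanSpace ℝ (Fin d))) (hX : MeasurableSet X)
    (U : Set (EuclideanSpace ℝ (Fin m))) (hU : IsCompact U)
    (c : X × U → ℝ) (hc_meas : Measurable c)
    (hc_bdd : ∃ M : ℝ, ∀ p, |c p| ≤ M)
    (hc_cont : ∀ x : X, Continuous fun u : U => c (x, u))
    (T : Kernel (X × U) X) [IsMarkovKernel T]
    (Tn : ℕ → Kernel (X × U) X) [∀ n, IsMarkovKernel (Tn n)]
    (hT_cont : AvgCost.SetwiseContinuousInAction T)
    (h_erg : AvgCost.UniformlyErgodic (insert T (Set.range Tn)))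
    (h_conv : ∀ (x : X) (u : U) (un : ℕ → U), Tendsto un atTop (𝓝 u) →
      Tendsto (fun n => AvgCost.tvDist (Tn n (x, un n)) (T (x, u))) atTop (𝓝 0))
    (x₀ : X) (γ : ℕ → AvgCost.StationaryPolicy X U)
    (hγ : ∀ n, AvgCost.IsOptimalStationary c (Tn n) x₀ (γ n)) :
    Tendsto (fun n => |AvgCost.avgCost c T (γ n).toPolicy x₀ - AvgCost.optCost c T x₀|)
      atTop (𝓝 0) := by
  have : CompactSpace U := isCompact_iff_compactSpace.1 hU
  have : Nonempty X := ⟨x₀⟩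
  have : Nonempty (AvgCost.StationaryPolicy X U) := ⟨γ 0⟩
  have : Nonempty U := ⟨(γ 0).act x₀⟩
  obtain ⟨M', hM'⟩ := hc_bdd
  obtain ⟨M, hM0, hM⟩ : ∃ M : ℝ, 0 < M ∧ ∀ p, |c p| ≤ M :=
    ⟨max M' 1, lt_max_of_lt_right one_pos, fun p => (hM' p).trans (le_max_left _ _)⟩
  have hMarkov : ∀ S ∈ insert T (Set.range Tn), IsMarkovKernel S := by
    rintro S (rfl | ⟨n, rfl⟩) <;> infer_instance
  obtain ⟨t, ht, β, hβ, hβ1, hosc⟩ := h_erg.oscContraction hMarkov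
  have hT := hosc T (Set.mem_insert _ _)
  have hTn := fun n => hosc (Tn n) (Set.mem_insert_of_mem _ ⟨n, rfl⟩)
  have hlim := AvgCost.tendsto_avgCost_sub hc_meas hM0 hM ht hβ hβ1
    (fun x u => AvgCost.tendsto_prod_of_forall_seq
      (F := fun n v => AvgCost.tvDist (Tn n (x, v)) (T (x, u))) (h_conv x u)) hT hTn
  rw [Metric.tendsto_nhds]
  intro ε hε
  obtain ⟨γ', hγ'⟩ := AvgCost.exists_avgCost_le_optCost_add hc_meas hM hc_cont hT_cont hβ1 hT x₀
    (show 0 < ε / 3 by linarith)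
  -- Three errors of `ε / 3`: from `T` to `Tn n` under `γ n`, back from `Tn n` to `T` under `γ'`,
  -- and the suboptimality of `γ'`.
  filter_upwards [Metric.tendsto_nhds.1 (hlim γ x₀) (ε / 3) (by linarith),
    Metric.tendsto_nhds.1 (hlim (fun _ => γ') x₀) (ε / 3) (by linarith)] with n h1 h2
  rw [Real.dist_0_eq_abs, abs_lt] at h1 h2
  have h3 := AvgCost.optCost_le (T := T) hc_meas hM (γ n).toPolicy x₀
  rw [Real.dist_0_eq_abs, abs_abs, abs_of_nonneg (by linarith)]
  linarith [hγ n γ', h1.1, h2.2]
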